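/- Let $\mathcal{A}$ be a finite arrangement of linear hyperplanes in a real vector space $V$ of finite dimension $d \ge 1$ (for instance $V=\mathbb{R}^d$) that is essential, i.e. $\bigcap_{H\in\mathcal{A}}H=\{0\}$. Let $L$ be the set of all intersections $\bigcap_{H\in S}H$, $S\subseteq\mathcal{A}$ (with $V$ as the empty intersection), and let $L_2$ be the set of members of $L$ of codimension two. For a subspace $X$, let $\mathcal{A}_X=\{H/X : H\in\mathcal{A},\ H\supseteq X\}$ be the localized arrangement in $V/X$. A line $\ell\in L$ is a modular coatom of $\mathcal{A}$ if for all distinct $H,H'\in\mathcal{A}$ not containing $\ell$ there is $H''\in\mathcal{A}$ containing both $\ell$ and $H\cap H'$. The arrangement $\mathcal{A}$ is supersolvable if $d=1$, or if it has a modular coatom $\ell$ for which $\mathcal{A}_\ell$ is supersolvable. A modular flag is a chain $F$: $\{0\}=X_0\subset X_1\subset\cdots\subset X_d=V$ of members of $L$ with $\dim X_i=i$ such that $X_i/X_{i-1}$ is a modular coatom of $\mathcal{A}_{X_{i-1}}$ for $1\le i\le d$. Chambers are the connected components of $V\setminus\bigcup_{H\in\mathcal{A}}H$. The graph $G_1$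 on the set of chambers joins two chambers if exactly one hyperplane of $\mathcal{A}$ separates them; a minimal gallery from $c$ to $c'$ is a shortest path from $c$ to $c'$ in $G_1$, and it crosses $H\in\mathcal{A}$ at a step if $H$ separates the two chambers of that step. A chamber $c$ is incident to $F$ if for each $i$ the cone $\overline{c}\cap X_i$ has dimension $i$. If $c_0$ is a chamber incident to $F$, a minimal gallery from $c_0$ to $-c_0$ is incident to $F$ if, whenever $i<j$, it crosses every hyperplane of $\mathcal{A}$ containing $X_j$ before every hyperplane of $\mathcal{A}$ containing $X_i$ but not $X_j$. For a chamber $c$, let $c/X$ be the chamber of $\mathcal{A}_X$ containing the image of $c$ in $V/X$; for a minimal gallery $r$, let $r/X$ be the sequence of the chambers $c/X$, for $c$ along $r$, with consecutive repetitions removed. For minimal galleries $r,r'$ from $c_0$ to $-c_0$ put $L_2(r,r')=\{X\in L_2 : r/X\ne r'/X\}$, and let $G_2$ be the graph on the set of all minimal galleries from $c_0$ to $-c_0$ in which $r,r'$ are adjacent if and only if $|L_2(r,r')|=1$. Theorem. Let $\mathcal{A}$ be supersolvable, let $F$ be a modular flag for $\mathcal{A}$, and let $c_0$ be any chamber incident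 to $F$. Then: (i) there is a unique minimal gallery $r_0$ from $c_0$ to $-c_0$ incident to $F$; (ii) this $r_0$ is $L_2$-accessible in $G_2$: for every minimal gallery $r$ from $c_0$ to $-c_0$, the distance $d_{G_2}(r_0,r)$ is finite and equals $|L_2(r_0,r)|$. -/

import Mathlib

open Pointwise

universe u

/-- A finite arrangement of linear hyperplanes in a real vector space `V`. -/
structure Arrangement (V : Type u) [AddCommGroup V] [Module ℝ V] where
  hyperplanes : Set (Submodule ℝ V)
  finite : hyperplanes.Finite
  codim_one : ∀ H ∈ hyperplanes, Module.finrank ℝ (V ⧸ H) = 1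

namespace Arrangement

section Linear

variable {V : Type u} [AddCommGroup V] [Module ℝ V]

/-- The hyperplanes have no common point except the origin. -/
def IsEssential (A : Arrangement V) : Prop :=
  sInf A.hyperplanes = ⊥

/-- The intersection lattice `L`: all intersections of sets of hyperplanes of `A`
(the empty intersection is the whole space). -/
def lattice (A : Arrangement V) : Set (Submodule ℝ V) :=
  {X | ∃ S ⊆ A.hyperplanes, X = sInf S}

/-- The `i`-th rank `L_i` of the intersection lattice: its members of codimension `i`. -/
def latticeRank (A : Arrangement V) (i : ℕ) : Set (Submodule ℝ V) :=
  {X ∈ A.lattice | Module.finrank ℝ (V ⧸ X) = i}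

/-- The hyperplanes of `A` that contain `X`. -/
def above (A : Arrangement V) (X : Submodule ℝ V) : Set (Submodule ℝ V) :=
  {H ∈ A.hyperplanes | X ≤ H}

/-- The localized arrangement `A_X = {H / X : H ∈ A, X ⊆ H}` in the quotient space `V / X`. -/
def localization (A : Arrangement V) (X : Submodule ℝ V) : Arrangement (V ⧸ X) where
  hyperplanes := (fun H => H.map X.mkQ) '' A.above X
  finite := (A.finite.subset fun _ h => h.1).image _
  codim_one := by
    rintro _ ⟨H, hH, rfl⟩
    exact (Submodule.quotientQuotientEquivQuotient X H hH.2).finrank_eq.trans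
      (A.codim_one H hH.1)

/-- A modular coatom: a line `ℓ` of the intersection lattice such that any two distinct
hyperplanes `H, H'` of `A` not containing `ℓ` admit a hyperplane of `A` that contains both `ℓ`
and `H ∩ H'`. -/
def IsModularCoatom (A : Arrangement V) (l : Submodule ℝ V) : Prop :=
  l ∈ A.lattice ∧ Module.finrank ℝ l = 1 ∧
    ∀ H ∈ A.hyperplanes, ∀ H' ∈ A.hyperplanes, H ≠ H' → ¬ l ≤ H → ¬ l ≤ H' →
      ∃ H'' ∈ A.hyperplanes, l ≤ H'' ∧ H ⊓ H' ≤ H''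

/-- Maximal flags `X_0 ⊂ X_1 ⊂ ⋯ ⊂ X_d` of members of the intersection lattice, where
`d = dim V` and `dim X_i = i`; in particular `X_0 = 0` and `X_d = V`. -/
structure Flag (A : Arrangement V) where
  space : Fin (Module.finrank ℝ V + 1) → Submodule ℝ V
  mem_lattice : ∀ i, space i ∈ A.lattice
  strictMono : StrictMono space
  finrank_eq : ∀ i, Module.finrank ℝ (space i) = i

/-- A flag is modular if `X_{i+1} / X_i` is a modular coatom of the localization `A_{X_i}`
for every `0 ≤ i < d`. -/
def Flag.IsModular {A : Arrangement V} (F : A.Flag) : Prop :=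
  ∀ i : Fin (Module.finrank ℝ V),
    (A.localization (F.space i.castSucc)).IsModularCoatom
      ((F.space i.succ).map (F.space i.castSucc).mkQ)

end Linear

/-- Supersolvability of an essential arrangement (whose rank is the dimension of the ambient
space): it has rank one, or a modular coatom whose localization is supersolvable. -/
inductive IsSupersolvable :
    ∀ {V : Type u} [AddCommGroup V] [Module ℝ V], Arrangement V → Prop
  | rank_one {V : Type u} [AddCommGroup V] [Module ℝ V] (A : Arrangement V)
      (h : Module.finrank ℝ V = 1) : IsSupersolvable A
  | step {V : Type u} [AddCommGroup V] [Module ℝ V] (A : Arrangement V) (l : Submodule ℝ V)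
      (hl : A.IsModularCoatom l) (h : IsSupersolvable (A.localization l)) : IsSupersolvable A

section Chambers

variable {V : Type u} [AddCommGroup V] [Module ℝ V]

/-- The complement of the union of the hyperplanes. -/
def complement (A : Arrangement V) : Set V :=
  {x | ∀ H ∈ A.hyperplanes, x ∉ H}

theorem neg_mem_complement {A : Arrangement V} {x : V} (hx : x ∈ A.complement) :
    -x ∈ A.complement :=
  fun H hH h => hx H hH (by simpa using H.neg_mem h)

theorem mkQ_mem_complement {A : Arrangement V} {x : V} (hx : x ∈ A.complement)
    (X : Submodule ℝ V) : X.mkQ x ∈ (A.localization X).complement := by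
  rintro _ ⟨H, hH, rfl⟩ ⟨y, hy, hxy⟩
  refine hx H hH.1 ?_
  have h : y - x ∈ X := (Submodule.Quotient.eq X).1 hxy
  simpa using H.sub_mem hy (hH.2 h)

variable [TopologicalSpace V]

/-- Chambers: the connected components of the complement of the hyperplanes. -/
def Chamber (A : Arrangement V) : Type u :=
  {c : Set V // ∃ x ∈ A.complement, c = connectedComponentIn A.complement x}

theorem Chamber.exists_mem {A : Arrangement V} (c : A.Chamber) : ∃ x, x ∈ c.1 := by
  obtain ⟨_, x, hx, rfl⟩ := c
  exact ⟨x, mem_connectedComponentIn hx⟩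

theorem Chamber.subset_complement {A : Arrangement V} (c : A.Chamber) :
    c.1 ⊆ A.complement := by
  obtain ⟨_, x, hx, rfl⟩ := c
  exact connectedComponentIn_subset _ _

/-- The antipodal chamber `-c`. -/
instance [IsTopologicalAddGroup V] (A : Arrangement V) : Neg A.Chamber where
  neg c := ⟨-c.1, by
    obtain ⟨_, x, hx, rfl⟩ := c
    refine ⟨-x, neg_mem_complement hx, ?_⟩
    have h := (Homeomorph.neg V).image_connectedComponentIn hx
    have h2 : (Homeomorph.neg V) '' A.complement = A.complement := by
      ext y
      constructor
      · rintro ⟨z, hz, rfl⟩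
        exact neg_mem_complement hz
      · intro hy
        exact ⟨-y, neg_mem_complement hy, neg_neg y⟩
    rw [h2] at h
    rw [← Set.image_neg_eq_neg]
    exact h⟩

/-- `H` separates `c` from `c'`: these lie in the two different open half-spaces bounded
by `H`. -/
def Separates (H : Submodule ℝ V) (c c' : Set V) : Prop :=
  ∃ f : V →ₗ[ℝ] ℝ, LinearMap.ker f = H ∧ (∀ x ∈ c, f x < 0) ∧ ∀ x ∈ c', 0 < f x

/-- The separation set `L_1(c, c')` of two chambers. -/
def sep₁ {A : Arrangement V} (c c' : A.Chamber) : Set (Submodule ℝ V) :=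
  {H ∈ A.hyperplanes | Separates H c.1 c'.1}

theorem sep₁_comm {A : Arrangement V} (c c' : A.Chamber) : sep₁ c c' = sep₁ c' c := by
  have key : ∀ (H : Submodule ℝ V) (a b : Set V), Separates H a b → Separates H b a := by
    rintro H a b ⟨f, hf, ha, hb⟩
    refine ⟨-f, ?_, fun x hx => by simpa using hb x hx, fun x hx => by simpa using ha x hx⟩
    ext x
    simp [← hf]
  ext H
  exact ⟨fun h => ⟨h.1, key _ _ _ h.2⟩, fun h => ⟨h.1, key _ _ _ h.2⟩⟩

theorem sep₁_self {A : Arrangement V} (c : A.Chamber) : sep₁ c c = ∅ := by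
  ext H
  simp only [Set.mem_empty_iff_false, iff_false]
  rintro ⟨-, f, -, h1, h2⟩
  obtain ⟨x, hx⟩ := c.exists_mem
  exact lt_asymm (h1 x hx) (h2 x hx)

/-- The graph `G_1` on the chambers: `c, c'` are adjacent iff `|L_1(c, c')| = 1`. -/
def G₁ (A : Arrangement V) : SimpleGraph A.Chamber where
  Adj c c' := (sep₁ c c').ncard = 1
  symm := ⟨fun c c' h => by rwa [sep₁_comm]⟩
  loopless := ⟨fun c h => by simp [sep₁_self] at h⟩

/-- A chamber is incident to the subspace `X` if its closure meets `X` in a cone of the same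
dimension as `X` (the dimension of a cone being that of its linear span). -/
def Chamber.IsIncident {A : Arrangement V} (c : A.Chamber) (X : Submodule ℝ V) : Prop :=
  Module.finrank ℝ (Submodule.span ℝ (closure c.1 ∩ (X : Set V))) = Module.finrank ℝ X

/-- A chamber is incident to a flag if it is incident to each of its members. -/
def Chamber.IsIncidentFlag {A : Arrangement V} (c : A.Chamber) (F : A.Flag) : Prop :=
  ∀ i, c.IsIncident (F.space i)

/-- The chamber `c / X` of `A_X`: the component containing the image of `c` in `V / X`
(see `Chamber.mkQ_mem_quot`). -/
noncomputable def Chamber.quot {A : Arrangement V} (c : A.Chamber) (X : Submodule ℝ V) :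
    (A.localization X).Chamber :=
  ⟨connectedComponentIn (A.localization X).complement (X.mkQ c.exists_mem.choose),
    _, mkQ_mem_complement (c.subset_complement c.exists_mem.choose_spec) X, rfl⟩

theorem Chamber.mkQ_mem_quot {A : Arrangement V} (c : A.Chamber) (X : Submodule ℝ V)
    {x : V} (hx : x ∈ c.1) : X.mkQ x ∈ (c.quot X).1 := by
  have hpre : IsPreconnected c.1 := by
    obtain ⟨_, y, hy, rfl⟩ := c
    exact isPreconnected_connectedComponentIn
  have hcont : Continuous X.mkQ := continuous_quot_mk
  refine (hpre.image X.mkQ hcont.continuousOn).subset_connectedComponentIn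
    (Set.mem_image_of_mem _ c.exists_mem.choose_spec) ?_ (Set.mem_image_of_mem _ hx)
  rintro _ ⟨y, hy, rfl⟩
  exact mkQ_mem_complement (c.subset_complement hy) X

/-- Minimal galleries from `c` to `c'`: the geodesics of `G_1`. -/
def MinimalGallery {A : Arrangement V} (c c' : A.Chamber) : Type u :=
  {w : A.G₁.Walk c c' // w.length = A.G₁.dist c c'}

variable {A : Arrangement V} {c c' : A.Chamber}

/-- The `n`-th step of the gallery `r` crosses the hyperplane `H`. -/
def MinimalGallery.CrossesAt (r : MinimalGallery c c') (H : Submodule ℝ V) (n : ℕ) : Prop :=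
  n < r.1.length ∧ H ∈ sep₁ (r.1.getVert n) (r.1.getVert (n + 1))

/-- The gallery `r` crosses `H` before `H'`. -/
def MinimalGallery.CrossesBefore (r : MinimalGallery c c') (H H' : Submodule ℝ V) : Prop :=
  ∃ m n, m < n ∧ r.CrossesAt H m ∧ r.CrossesAt H' n

/-- The gallery `r` is incident to the flag `F`: whenever `i < j`, it crosses the hyperplanes
containing `X_j` before those containing `X_i` but not `X_j`. -/
def MinimalGallery.IsIncidentFlag (r : MinimalGallery c c') (F : A.Flag) : Prop :=
  ∀ i j, i < j → ∀ H ∈ A.above (F.space j), ∀ H' ∈ A.above (F.space i) \ A.above (F.space j),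
    r.CrossesBefore H H'

open Classical in
/-- The induced gallery `r / X` of `A_X`, as the sequence of chambers it visits: the chambers
`c_i / X` for `c_i` along `r`, with consecutive repetitions removed. -/
noncomputable def MinimalGallery.quot (r : MinimalGallery c c') (X : Submodule ℝ V) :
    List (A.localization X).Chamber :=
  (r.1.support.map fun b => b.quot X).destutter (· ≠ ·)

/-- The separation set `L_2(r, r')` of two minimal galleries: those `X` in `L_2` with
`r / X ≠ r' / X`. -/
def sep₂ (r r' : MinimalGallery c c') : Set (Submodule ℝ V) :=
  {X ∈ A.latticeRank 2 | r.quot X ≠ r'.quot X}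

/-- The graph `G_2` on the minimal galleries from `c` to `c'`: `r, r'` are adjacent iff
`|L_2(r, r')| = 1`. -/
def G₂ (c c' : A.Chamber) : SimpleGraph (MinimalGallery c c') where
  Adj r r' := (sep₂ r r').ncard = 1
  symm := ⟨fun r r' h => by
    have : sep₂ r' r = sep₂ r r' := by
      ext X
      simp [sep₂, ne_comm]
    rwa [this]⟩
  loopless := ⟨fun r h => by simp [sep₂] at h⟩

end Chambers

end Arrangement

/-- For a graph `G` and a set-valued function `Ω` of two vertices, the vertex `x₀` is
`Ω`-accessible if `d_G(x₀, y) = |Ω(x₀, y)|` for every vertex `y`. The distance is the extended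
one, so it is `⊤` between different components. -/
def SimpleGraph.IsAccessible {W E : Type*} (G : SimpleGraph W) (Ω : W → W → Set E) (x₀ : W) :
    Prop :=
  ∀ y, G.edist x₀ y = (Ω x₀ y).encard

/-! Choose defining functionals `f H` that are positive on `c₀`. Chambers become sign patterns. A
minimal gallery from `c₀` to `-c₀` crosses every hyperplane once, so it is an enumeration of the
hyperplanes whose initial segments are the negative sets of chambers (`IsGalleryList`). For a flat
`X` of codimension two, `r / X` records just the order of crossing the hyperplanes through `X`
(`quot_eq_quot_iff`). The order of any two of them determines the rest, because of three hyperplanes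
in a pencil the middle one is crossed between the others (`IsGalleryList.before_iff_of_coplanar`).

Modularity enters through a vector `v` in the closure of `c₀` that lies in the next member of the
flag but not in the current one. If `B` and `B'` are the hyperplanes through the current and the
next member, any two hyperplanes of `B \ B'` span a pencil containing one of `B'` (`IsModularStep`).
Hence the line `-x₀ + ℝ v` meets `B \ B'` one hyperplane at a time, which builds the incident
gallery stage by stage. It is unique, since each such pencil contains an earlier crossing that fixes
its order.

The distance in `G₂` is at least `|L₂|` by a triangle inequality. For equality it suffices that
every `r ≠ r₀` can be flipped at a single flat so as to agree with `r₀` there. If `r` crosses some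
`k ∈ B'` after hyperplanes outside `B'`, take the first such `k` and a point `y` on the wall where
it is crossed. Moving `y` along `v` stays in `k`, and modularity shows that the first new hyperplane
met is the one `g` crossed just before `k`. At the point reached in `k ⊓ g`, the hyperplanes through
this flat form a consecutive block of `r` ending in `k`, and the block can be reversed
(`IsModularStep.exists_flip`). If `r` crosses all of `B'` first, the argument passes to its initial
part (`exists_tower_flip`). -/

/-! ### Order of first occurrence in lists. -/

section Lists

variable {ι : Type*}

theorem List.IsPrefix.cases_append {p a b : List ι} (h : p <+: a ++ b) :
    p <+: a ∨ ∃ m, p = a ++ m ∧ m <+: b := by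
  rcases List.prefix_or_prefix_of_prefix h (List.prefix_append a b) with h' | ⟨m, rfl⟩
  · exact Or.inl h'
  · exact Or.inr ⟨m, rfl, (List.prefix_append_right_inj a).1 h⟩

theorem List.IsPrefix.cases_cons {p b : List ι} {a : ι} (h : p <+: a :: b) :
    p = [] ∨ ∃ m, p = a :: m ∧ m <+: b := by
  cases p with
  | nil => exact Or.inl rfl
  | cons x m =>
    obtain ⟨rfl, hm⟩ := List.cons_prefix_cons.1 h
    exact Or.inr ⟨m, rfl, hm⟩

/-- A list along which `P` is preserved splits into a block violating `P` and one satisfying it. -/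
theorem List.Pairwise.exists_split {P : ι → Prop} {l : List ι}
    (h : l.Pairwise fun a b => P a → P b) :
    ∃ u w, l = u ++ w ∧ (∀ i ∈ u, ¬ P i) ∧ ∀ i ∈ w, P i := by
  induction l with
  | nil => exact ⟨[], [], by simp⟩
  | cons a t ih =>
    rw [List.pairwise_cons] at h
    by_cases ha : P a
    · exact ⟨[], a :: t, rfl, by simp, by simpa [ha] using fun b hb => h.1 b hb ha⟩
    · obtain ⟨u, w, rfl, hu, hw⟩ := ih h.2
      exact ⟨a :: u, w, rfl, by simpa [ha] using hu, hw⟩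

variable [DecidableEq ι]

/-- `a` occurs in `l`, and its first occurrence precedes every occurrence of `b`. -/
def List.Before (l : List ι) (a b : ι) : Prop := l.idxOf a < l.idxOf b

/-- Translates order into initial segments, which are what `IsGalleryList` controls. An absent entry
has index `l.length`, so the relation also holds when `a` occurs and `b` does not. -/
theorem List.before_iff_prefix {l : List ι} {a b : ι} :
    l.Before a b ↔ ∃ p, p <+: l ∧ a ∈ p ∧ b ∉ p := by
  constructor
  · intro h
    have ha : a ∈ l := List.idxOf_lt_length_iff.1 (lt_of_lt_of_le h List.idxOf_le_length)
    refine ⟨l.take (l.idxOf a + 1), List.take_prefix _ _, ?_, ?_⟩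
    · rw [List.mem_take_iff_idxOf_lt ha]
      exact Nat.lt_succ_self _
    · intro hb
      have hb' := (List.mem_take_iff_idxOf_lt (List.mem_of_mem_take hb)).1 hb
      unfold List.Before at h
      omega
  · rintro ⟨p, ⟨s, rfl⟩, ha, hb⟩
    unfold List.Before
    rw [List.idxOf_append_of_mem ha, List.idxOf_append_of_notMem hb]
    have := List.idxOf_lt_length_iff.2 ha
    omega

theorem List.Before.asymm {l : List ι} {a b : ι} (h : l.Before a b) : ¬ l.Before b a :=
  Nat.lt_asymm h

theorem List.before_or_before {l : List ι} {a b : ι} (ha : a ∈ l) (hab : a ≠ b) :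
    l.Before a b ∨ l.Before b a :=
  Nat.lt_or_gt_of_ne fun h => hab ((List.idxOf_inj ha).1 h)

theorem List.before_append_left {p s : List ι} {a b : ι} (ha : a ∈ p) (hb : b ∉ p) :
    (p ++ s).Before a b :=
  List.before_iff_prefix.2 ⟨p, List.prefix_append _ _, ha, hb⟩

theorem List.before_append_of_before {p s : List ι} {a b : ι} (h : p.Before a b) :
    (p ++ s).Before a b := by
  obtain ⟨q, hq, ha, hb⟩ := List.before_iff_prefix.1 h
  exact List.before_iff_prefix.2 ⟨q, hq.trans (List.prefix_append _ _), ha, hb⟩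

theorem List.Nodup.pairwise_before {l : List ι} (hl : l.Nodup) : l.Pairwise l.Before := by
  rw [List.pairwise_iff_getElem]
  intro i j hi hj hij
  unfold List.Before
  rwa [hl.idxOf_getElem, hl.idxOf_getElem]

/-- The lists are permutations of each other, both sorted by the asymmetric relation `l'.Before`. -/
theorem List.eq_of_before_imp {l l' : List ι} (hl : l.Nodup) (hl' : l'.Nodup)
    (hmem : ∀ a, a ∈ l ↔ a ∈ l') (h : ∀ a ∈ l, ∀ b ∈ l, l.Before a b → l'.Before a b) :
    l = l' := by
  have hperm : l.Perm l' := (List.perm_ext_iff_of_nodup hl hl').2 hmem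
  refine List.Perm.eq_of_pairwise (le := l'.Before) ?_ ?_ hl'.pairwise_before hperm
  · intro a b _ _ hab hba
    exact absurd hba hab.asymm
  · exact List.Pairwise.imp_of_mem (fun ha hb hab => h _ ha _ hb hab) hl.pairwise_before

/-- Rearranging an interior block of a list only changes the relative order inside the block. -/
theorem List.Before.rearrange {q m m' s : List ι} (hm : ∀ a, a ∈ m ↔ a ∈ m') {a b : ι}
    (h : (q ++ m ++ s).Before a b) : (q ++ m' ++ s).Before a b ∨ (a ∈ m ∧ b ∈ m) := by
  obtain ⟨p, hp, ha, hb⟩ := List.before_iff_prefix.1 h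
  simp only [List.before_iff_prefix]
  rcases hp.cases_append with hp | ⟨s₁, rfl, hs₁⟩
  · rcases hp.cases_append with hp | ⟨m₁, rfl, hm₁⟩
    · exact Or.inl ⟨p, hp.trans (by simp), ha, hb⟩
    · by_cases haq : a ∈ q
      · exact Or.inl ⟨q, by simp, haq, fun h => hb (by simp [h])⟩
      by_cases hbm : b ∈ m
      · refine Or.inr ⟨hm₁.subset ?_, hbm⟩
        simpa [haq] using ha
      · refine Or.inl ⟨q ++ m', by simp, ?_, ?_⟩
        · have : a ∈ m := hm₁.subset (by simpa [haq] using ha)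
          simp [← hm, this]
        · have : b ∉ q := fun h => hb (by simp [h])
          simp [← hm, this, hbm]
  · refine Or.inl ⟨q ++ m' ++ s₁, by simpa using hs₁, ?_, ?_⟩
    · simpa [hm] using ha
    · simpa [hm] using hb

/-- If some entry violating `P` precedes an entry satisfying `P`, the list starts with a block
satisfying `P`, a nonempty block violating `P`, and an entry satisfying `P`. -/
theorem List.exists_blocks (P : ι → Prop) {l : List ι} {a b : ι} (h : l.Before a b) (hb : b ∈ l)
    (ha : ¬ P a) (hPb : P b) :
    ∃ p u k s, l = p ++ u ++ k :: s ∧ u ≠ [] ∧ (∀ i ∈ p, P i) ∧ (∀ i ∈ u, ¬ P i) ∧ P k := by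
  classical
  induction l with
  | nil => simp at hb
  | cons c t ih =>
    by_cases hc : P c
    · have hac : a ≠ c := fun h => ha (h ▸ hc)
      have hbc : b ≠ c := by
        rintro rfl
        simp [List.Before] at h
      have h' : t.Before a b := by
        unfold List.Before at h ⊢
        rw [List.idxOf_cons_ne _ (Ne.symm hac), List.idxOf_cons_ne _ (Ne.symm hbc)] at h
        omega
      obtain ⟨p, u, k, s, rfl, hu, hp, hu', hk⟩ := ih h' (by simpa [hbc] using hb)
      exact ⟨c :: p, u, k, s, by simp, hu, by simpa [hc] using hp, hu', hk⟩
    · have hbt : b ∈ t := by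
        rcases List.mem_cons.1 hb with rfl | hb
        · exact absurd hPb hc
        · exact hb
      have key : ∀ t : List ι, b ∈ t → ∃ u k s, t = u ++ k :: s ∧ (∀ i ∈ u, ¬ P i) ∧ P k := by
        intro t
        induction t with
        | nil => simp
        | cons d t ih =>
          intro hbt
          by_cases hd : P d
          · exact ⟨[], d, t, rfl, by simp, hd⟩
          · obtain ⟨u, k, s, rfl, hu, hk⟩ := ih (by
              rcases List.mem_cons.1 hbt with rfl | hb
              · exact absurd hPb hd
              · exact hb)
            exact ⟨d :: u, k, s, rfl, by simpa [hd] using hu, hk⟩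
      obtain ⟨u, k, s, rfl, hu, hk⟩ := key t hbt
      exact ⟨[], c :: u, k, s, rfl, by simp, by simp, by simpa [hc] using hu, hk⟩

end Lists

/-! ### Sign patterns, gallery lists and pencils of hyperplanes. -/

section Functionals

variable {V : Type*} [AddCommGroup V] [Module ℝ V] {ι : Type*}

/-- A set `S` is realizable with respect to the functionals `f i`, `i ∈ B`, if some vector is
negative for exactly those in `S` and positive for the others. -/
def Realizable (f : ι → Module.Dual ℝ V) (B : Finset ι) (S : Set ι) : Prop :=
  ∃ x, ∀ i ∈ B, (i ∈ S → f i x < 0) ∧ (i ∉ S → 0 < f i x)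

/-- Enumerations of `B` all of whose initial segments are realizable: these encode the minimal
galleries from the positive chamber to its antipode. -/
structure IsGalleryList (f : ι → Module.Dual ℝ V) (B : Finset ι) (l : List ι) : Prop where
  nodup : l.Nodup
  mem_iff : ∀ i, i ∈ l ↔ i ∈ B
  realizable : ∀ p, p <+: l → Realizable f B {i | i ∈ p}

theorem Realizable.congr {f : ι → Module.Dual ℝ V} {B : Finset ι} {S T : Set ι}
    (h : Realizable f B S) (hST : ∀ i ∈ B, i ∈ S ↔ i ∈ T) : Realizable f B T := by
  obtain ⟨x, hx⟩ := h
  refine ⟨x, fun i hi => ?_⟩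
  rw [← hST i hi]
  exact hx i hi

theorem Realizable.mono {f : ι → Module.Dual ℝ V} {B B' : Finset ι} {S : Set ι}
    (h : Realizable f B S) (hB : B' ⊆ B) : Realizable f B' S := by
  obtain ⟨x, hx⟩ := h
  exact ⟨x, fun i hi => hx i (hB hi)⟩

/-- A small perturbation keeps the strict signs. -/
theorem exists_perturbation (B : Finset ι) (g h : ι → ℝ) :
    ∃ ε > 0, ∀ i ∈ B, (g i < 0 → g i + ε * h i < 0) ∧ (0 < g i → 0 < g i + ε * h i) := by
  have key : ∀ i ∈ B, ∀ᶠ ε in nhdsWithin (0 : ℝ) (Set.Ioi 0),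
      (g i < 0 → g i + ε * h i < 0) ∧ (0 < g i → 0 < g i + ε * h i) := by
    intro i _
    have hc : Filter.Tendsto (fun ε : ℝ => g i + ε * h i) (nhdsWithin 0 (Set.Ioi 0))
        (nhds (g i)) := by
      have : Continuous fun ε : ℝ => g i + ε * h i := by fun_prop
      simpa using (this.tendsto 0).mono_left nhdsWithin_le_nhds
    rcases lt_trichotomy (g i) 0 with h0 | h0 | h0
    · filter_upwards [hc.eventually (gt_mem_nhds h0)] with ε hε
      exact ⟨fun _ => hε, fun h => absurd h h0.not_gt⟩
    · simp [h0]
    · filter_upwards [hc.eventually (lt_mem_nhds h0)] with ε hε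
      exact ⟨fun h => absurd h h0.not_gt, fun _ => hε⟩
  have hall := (Filter.eventually_all_finset B).2 key
  obtain ⟨ε, hε, hpos⟩ := (hall.and self_mem_nhdsWithin).exists
  exact ⟨ε, hpos, hε⟩

variable {f : ι → Module.Dual ℝ V} {B B' : Finset ι}

/-- The functionals `f i`, `i ∈ B`, are pairwise nonproportional and have a common positive
point. -/
structure IsPositiveSystem (f : ι → Module.Dual ℝ V) (B : Finset ι) (x₀ : V) : Prop where
  pos : ∀ i ∈ B, 0 < f i x₀
  indep : ∀ i ∈ B, ∀ j ∈ B, i ≠ j → ∀ α : ℝ, f i ≠ α • f j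

/-- Among three distinct coplanar hyperplanes, one is between the other two. -/
theorem IsPositiveSystem.exists_middle {x₀ : V} (h : IsPositiveSystem f B x₀) {a b c : ι}
    (ha : a ∈ B) (hb : b ∈ B) (hc : c ∈ B) (hac : a ≠ c) (hbc : b ≠ c) {α β : ℝ}
    (hr : f c = α • f a + β • f b) :
    (∃ s t : ℝ, 0 < s ∧ 0 < t ∧ f c = s • f a + t • f b) ∨
      (∃ s t : ℝ, 0 < s ∧ 0 < t ∧ f a = s • f c + t • f b) ∨
        (∃ s t : ℝ, 0 < s ∧ 0 < t ∧ f b = s • f c + t • f a) := by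
  have hα : α ≠ 0 := by
    rintro rfl
    exact h.indep c hc b hb hbc.symm β (by simpa using hr)
  have hβ : β ≠ 0 := by
    rintro rfl
    exact h.indep c hc a ha hac.symm α (by simpa using hr)
  have hx : f c x₀ = α * f a x₀ + β * f b x₀ := by rw [hr]; simp
  have pa := h.pos a ha
  have pb := h.pos b hb
  have pc := h.pos c hc
  have ea : f a = α⁻¹ • f c + (-β * α⁻¹) • f b := by
    rw [hr, smul_add, smul_smul, smul_smul, inv_mul_cancel₀ hα, one_smul, add_assoc, ← add_smul]
    ring_nf
    simp
  have eb : f b = β⁻¹ • f c + (-α * β⁻¹) • f a := by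
    rw [hr, smul_add, smul_smul, smul_smul, inv_mul_cancel₀ hβ, one_smul]
    rw [add_comm (_ • f a), add_assoc, ← add_smul]
    ring_nf
    simp
  -- Two negative coefficients contradict positivity at `x₀`. With one negative coefficient, moving
  -- that term across exhibits `a` or `b` as the middle one.
  rcases lt_or_gt_of_ne hα with h1 | h1 <;> rcases lt_or_gt_of_ne hβ with h2 | h2
  · nlinarith [mul_pos (neg_pos.2 h1) pa, mul_pos (neg_pos.2 h2) pb]
  · exact Or.inr (Or.inr ⟨_, _, inv_pos.2 h2, mul_pos (neg_pos.2 h1) (inv_pos.2 h2), eb⟩)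
  · exact Or.inr (Or.inl ⟨_, _, inv_pos.2 h1, mul_pos (neg_pos.2 h2) (inv_pos.2 h1), ea⟩)
  · exact Or.inl ⟨α, β, h1, h2, hr⟩

variable [DecidableEq ι] {l : List ι}

/-- A hyperplane whose functional is a positive combination of two others is crossed between
them. -/
theorem IsGalleryList.between (hl : IsGalleryList f B l) {p m q : ι} (hp : p ∈ B) (hm : m ∈ B)
    (hq : q ∈ B) (hpm : p ≠ m) (hqm : q ≠ m) {α β : ℝ} (hα : 0 < α) (hβ : 0 < β)
    (h : f m = α • f p + β • f q) :
    (l.Before p m ∧ l.Before m q) ∨ (l.Before q m ∧ l.Before m p) := by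
  have hpl := (hl.mem_iff p).2 hp
  have hql := (hl.mem_iff q).2 hq
  have hml := (hl.mem_iff m).2 hm
  have hf : ∀ x, f m x = α * f p x + β * f q x := fun x => by rw [h]; simp
  -- If `m` came after both or before both, some initial segment would give `f p` and `f q` one sign
  -- and `f m` the other, against the positive combination.
  rcases List.before_or_before hpl hpm with h1 | h1 <;>
    rcases List.before_or_before hql hqm with h2 | h2
  · exfalso
    -- the longer of the two initial segments that end before `m` contains `p` and `q`
    have : ∃ r, r <+: l ∧ p ∈ r ∧ q ∈ r ∧ m ∉ r := by
      refine ⟨l.take (l.idxOf m), List.take_prefix _ _, ?_, ?_, ?_⟩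
      · exact (List.mem_take_iff_idxOf_lt hpl).2 h1
      · exact (List.mem_take_iff_idxOf_lt hql).2 h2
      · simp [List.mem_take_iff_idxOf_lt hml]
    obtain ⟨r, hr, h3, h4, h5⟩ := this
    obtain ⟨x, hx⟩ := hl.realizable r hr
    have e1 := (hx p hp).1 h3
    have e2 := (hx q hq).1 h4
    have e3 := (hx m hm).2 h5
    rw [hf] at e3
    nlinarith [mul_pos hα (neg_pos.2 e1), mul_pos hβ (neg_pos.2 e2)]
  · exact Or.inl ⟨h1, h2⟩
  · exact Or.inr ⟨h2, h1⟩
  · exfalso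
    have : ∃ r, r <+: l ∧ p ∉ r ∧ q ∉ r ∧ m ∈ r := by
      refine ⟨l.take (l.idxOf m + 1), List.take_prefix _ _, ?_, ?_, ?_⟩
      · rw [List.mem_take_iff_idxOf_lt hpl]
        unfold List.Before at h1
        omega
      · rw [List.mem_take_iff_idxOf_lt hql]
        unfold List.Before at h2
        omega
      · simp [List.mem_take_iff_idxOf_lt hml]
    obtain ⟨r, hr, h3, h4, h5⟩ := this
    obtain ⟨x, hx⟩ := hl.realizable r hr
    have e1 := (hx p hp).2 h3
    have e2 := (hx q hq).2 h4
    have e3 := (hx m hm).1 h5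
    rw [hf] at e3
    nlinarith [mul_pos hα e1, mul_pos hβ e2]

/-- Two galleries that cross two hyperplanes in the same order cross any third one through their
intersection in the same order. -/
theorem IsGalleryList.before_congr_of_coplanar {x₀ : V} (h : IsPositiveSystem f B x₀)
    {l l' : List ι} (hl : IsGalleryList f B l) (hl' : IsGalleryList f B l') {a b c : ι}
    (ha : a ∈ B) (hb : b ∈ B) (hc : c ∈ B) (hab : a ≠ b) (hac : a ≠ c) (hbc : b ≠ c) {α β : ℝ}
    (hr : f c = α • f a + β • f b) (hb1 : l.Before a b) (hb2 : l'.Before a b) :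
    (l.Before a c ↔ l'.Before a c) ∧ (l.Before b c ↔ l'.Before b c) := by
  -- Once the middle one is known, `between` leaves two mutually reverse orders, and `a` before `b`
  -- selects the same one in both lists.
  rcases h.exists_middle ha hb hc hac hbc hr with
    ⟨s, t, hs, ht, e⟩ | ⟨s, t, hs, ht, e⟩ | ⟨s, t, hs, ht, e⟩
  · have h1 := hl.between ha hc hb hac hbc hs ht e
    have h2 := hl'.between ha hc hb hac hbc hs ht e
    unfold List.Before at *
    omega
  · have h1 := hl.between hc ha hb hac.symm hab.symm hs ht e
    have h2 := hl'.between hc ha hb hac.symm hab.symm hs ht e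
    unfold List.Before at *
    omega
  · have h1 := hl.between hc hb ha hbc.symm hab hs ht e
    have h2 := hl'.between hc hb ha hbc.symm hab hs ht e
    unfold List.Before at *
    omega

/-- Two galleries that cross two hyperplanes in the same order cross all the hyperplanes through
their intersection in the same order. -/
theorem IsGalleryList.before_iff_of_coplanar {x₀ : V} (h : IsPositiveSystem f B x₀)
    {l l' : List ι} (hl : IsGalleryList f B l) (hl' : IsGalleryList f B l') {i j : ι}
    (hi : i ∈ B) (hj : j ∈ B) (hij : i ≠ j) (hb1 : l.Before i j) (hb2 : l'.Before i j) {a b : ι}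
    (ha : a ∈ B) (hb : b ∈ B) (hra : ∃ α β : ℝ, f a = α • f i + β • f j)
    (hrb : ∃ α β : ℝ, f b = α • f i + β • f j) : l.Before a b ↔ l'.Before a b := by
  have sym : ∀ {l : List ι} (_ : IsGalleryList f B l) {x y : ι}, x ∈ B → x ≠ y →
      (l.Before y x ↔ ¬ l.Before x y) := by
    intro l hl x y hx hxy
    have := List.before_or_before ((hl.mem_iff x).2 hx) hxy
    unfold List.Before at *
    omega
  have fromi : ∀ c ∈ B, (∃ α β : ℝ, f c = α • f i + β • f j) →
      (l.Before i c ↔ l'.Before i c) := by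
    rintro c hc ⟨α, β, hr⟩
    by_cases hic : i = c
    · subst hic
      simp [List.Before]
    by_cases hjc : j = c
    · subst hjc
      simp [hb1, hb2]
    exact (before_congr_of_coplanar h hl hl' hi hj hc hij hic hjc hr hb1 hb2).1
  by_cases hab : a = b
  · subst hab
    simp [List.Before]
  by_cases hai : i = a
  · subst hai
    exact fromi b hb hrb
  by_cases hbi : i = b
  · subst hbi
    rw [sym hl hi hai, sym hl' hi hai, fromi a ha hra]
  obtain ⟨α, β, ea⟩ := hra
  obtain ⟨γ, δ, eb⟩ := hrb
  have hβ : β ≠ 0 := by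
    rintro rfl
    exact h.indep a ha i hi (Ne.symm hai) α (by simpa using ea)
  -- The pencil is also spanned by `i` and `a`, whose order is already known to agree in the two
  -- lists.
  have er : f b = (γ - δ * α * β⁻¹) • f i + (δ * β⁻¹) • f a := by
    rw [ea, eb, smul_add, smul_smul, smul_smul, inv_mul_cancel_right₀ hβ,
      ← add_assoc, ← add_smul]
    congr 2
    ring
  by_cases hia : l.Before i a
  · have hia' := (fromi a ha ⟨α, β, ea⟩).1 hia
    exact (before_congr_of_coplanar h hl hl' hi ha hb hai hbi hab er hia hia').2
  · have hia' : ¬ l'.Before i a := fun h => hia ((fromi a ha ⟨α, β, ea⟩).2 h)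
    rw [← sym hl hi hai] at hia
    rw [← sym hl' hi hai] at hia'
    exact (before_congr_of_coplanar h hl hl' ha hi hb (Ne.symm hai) hab hbi
      (er.trans (add_comm _ _)) hia hia').1

end Functionals

/-! ### One modular step: enumeration of a level, and flips. -/

section Modular

variable {V : Type*} [AddCommGroup V] [Module ℝ V] {ι : Type*}

/-- `B'` is the part of `B` of functionals vanishing at `v`, the others being positive at `v`, and
any two functionals of `B \ B'` span a plane containing a functional of `B'`. -/
structure IsModularStep (f : ι → Module.Dual ℝ V) (B' B : Finset ι) (v : V) : Prop where
  subset : B' ⊆ B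
  zero : ∀ k ∈ B', f k v = 0
  pos : ∀ i ∈ B, i ∉ B' → 0 < f i v
  modular : ∀ i ∈ B, i ∉ B' → ∀ j ∈ B, j ∉ B' → i ≠ j →
    ∃ k ∈ B', ∃ c : ℝ, c ≠ 0 ∧ f j v • f i - f i v • f j = c • f k

variable {f : ι → Module.Dual ℝ V} {B B' : Finset ι} {v : V}

/-- At `v` the functionals outside `B'` are positive and those of `B'` vanish, so a small step from
`v` along a realizing vector decides only the signs on `B'`. -/
theorem IsModularStep.realizable_of_subset (h : IsModularStep f B' B v) {S : Set ι}
    (hS : ∀ i ∈ S, i ∈ B') (hr : Realizable f B' S) : Realizable f B S := by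
  obtain ⟨x, hx⟩ := hr
  obtain ⟨ε, hε, he⟩ := exists_perturbation B (fun i => f i v) (fun i => f i x)
  refine ⟨v + ε • x, fun i hi => ?_⟩
  simp only [map_add, map_smul, smul_eq_mul]
  by_cases hi' : i ∈ B'
  · rw [h.zero i hi', zero_add]
    exact ⟨fun hS => mul_neg_of_pos_of_neg hε ((hx i hi').1 hS),
      fun hS => mul_pos hε ((hx i hi').2 hS)⟩
  · exact ⟨fun h => absurd (hS i h) hi', fun _ => (he i hi).2 (h.pos i hi hi')⟩

/-- Along `-x₀ + ℝ v` the hyperplanes outside `B'` are crossed one at a time. -/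
theorem IsModularStep.exists_enumeration (h : IsModularStep f B' B v) {x₀ : V}
    (hx₀ : ∀ i ∈ B, 0 < f i x₀) :
    ∃ w : List ι, w.Nodup ∧ (∀ i, i ∈ w ↔ i ∈ B ∧ i ∉ B') ∧
      ∀ p, p <+: w → Realizable f B {i | i ∈ B' ∨ i ∈ p} := by
  classical
  -- `ρ i` is the time `t` at which `-x₀ + t • v` meets hyperplane `i`, and `f i` is negative for
  -- smaller `t`. Decreasing `t` therefore crosses in decreasing order of `ρ`.
  let ρ : ι → ℝ := fun i => f i x₀ / f i v
  let w := (B \ B').toList.mergeSort fun a b => decide (ρ b ≤ ρ a)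
  have hperm : w.Perm (B \ B').toList := List.mergeSort_perm _ _
  have hnodup : w.Nodup := hperm.nodup_iff.2 (Finset.nodup_toList _)
  have hmem : ∀ i, i ∈ w ↔ i ∈ B ∧ i ∉ B' := fun i => by rw [hperm.mem_iff]; simp
  -- Equal times would force `f k x₀ = 0` for the hyperplane `k ∈ B'` supplied by modularity.
  have hinj : ∀ i ∈ w, ∀ j ∈ w, i ≠ j → ρ i ≠ ρ j := by
    intro i hi j hj hij he
    rw [hmem] at hi hj
    obtain ⟨k, hk, c, hc, e⟩ := h.modular i hi.1 hi.2 j hj.1 hj.2 hij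
    have pi := h.pos i hi.1 hi.2
    have pj := h.pos j hj.1 hj.2
    have e' := congrArg (fun g : Module.Dual ℝ V => g x₀) e
    simp only [LinearMap.sub_apply, LinearMap.smul_apply, smul_eq_mul] at e'
    have : f i x₀ * f j v = f j x₀ * f i v := (div_eq_div_iff pi.ne' pj.ne').1 he
    have h0 : c * f k x₀ = 0 := by linarith
    exact (mul_ne_zero hc (hx₀ k (h.subset hk)).ne') h0
  have hsort : w.Pairwise fun a b => ρ b < ρ a := by
    have h1 : w.Pairwise fun a b => decide (ρ b ≤ ρ a) = true :=
      List.pairwise_mergeSort (by simpa using fun a b c h1 h2 => le_trans h2 h1)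
        (by simpa using fun a b => le_total _ _) _
    refine (h1.and hnodup).imp_of_mem fun {a b} ha hb hab => ?_
    exact lt_of_le_of_ne (by simpa using hab.1) (hinj b hb a ha (Ne.symm hab.2))
  refine ⟨w, hnodup, hmem, ?_⟩
  rintro p ⟨s, hps⟩
  rw [← hps, List.pairwise_append] at hsort
  obtain ⟨t, ht1, ht2⟩ := Order.exists_between_finsets (s.toFinset.image ρ) (p.toFinset.image ρ) (by
    simp only [Finset.mem_image, List.mem_toFinset]
    rintro _ ⟨a, ha, rfl⟩ _ ⟨b, hb, rfl⟩
    exact hsort.2.2 b hb a ha)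
  refine ⟨-x₀ + t • v, fun i hi => ?_⟩
  simp only [map_add, map_neg, map_smul, smul_eq_mul, Set.mem_ofPred_eq]
  by_cases hi' : i ∈ B'
  · simp [hi', h.zero i hi', hx₀ i hi]
  · have pv := h.pos i hi hi'
    simp only [hi', false_or]
    constructor
    · intro hp
      have : t < f i x₀ / f i v := ht2 _ (by
        simp only [Finset.mem_image, List.mem_toFinset]
        exact ⟨i, hp, rfl⟩)
      rw [lt_div_iff₀ pv] at this
      linarith
    · intro hp
      have his : i ∈ s := by
        have : i ∈ p ++ s := by rw [hps, hmem]; exact ⟨hi, hi'⟩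
        simpa [hp] using this
      have : f i x₀ / f i v < t := ht1 _ (by
        simp only [Finset.mem_image, List.mem_toFinset]
        exact ⟨i, his, rfl⟩)
      rw [div_lt_iff₀ pv] at this
      linarith

/-- Lifting a gallery of `B'` to one of `B` that crosses `B'` first. -/
theorem IsModularStep.append_gallery (h : IsModularStep f B' B v) {l w : List ι}
    (hl : IsGalleryList f B' l) (hw : w.Nodup) (hmem : ∀ i, i ∈ w ↔ i ∈ B ∧ i ∉ B')
    (hreal : ∀ p, p <+: w → Realizable f B {i | i ∈ B' ∨ i ∈ p}) : IsGalleryList f B (l ++ w) := by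
  refine ⟨List.nodup_append'.2 ⟨hl.nodup, hw, ?_⟩, ?_, ?_⟩
  · intro i hi hi'
    exact ((hmem i).1 hi').2 ((hl.mem_iff i).1 hi)
  · intro i
    rw [List.mem_append, hl.mem_iff, hmem]
    have := @h.subset i
    tauto
  · intro p hp
    rcases hp.cases_append with hp | ⟨m, rfl, hm⟩
    · exact h.realizable_of_subset (fun i hi => (hl.mem_iff i).1 (hp.subset hi))
        (hl.realizable p hp)
    · refine (hreal m hm).congr fun i _ => ?_
      simp [hl.mem_iff]

/-- A gallery of `B` that crosses `B'` first is a gallery of `B'` followed by an enumeration of the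
rest. -/
theorem IsModularStep.split_gallery [DecidableEq ι] (h : IsModularStep f B' B v) {l : List ι}
    (hl : IsGalleryList f B l) (hfirst : ∀ k ∈ B', ∀ i ∈ B, i ∉ B' → l.Before k i) :
    ∃ l₁ w, l = l₁ ++ w ∧ IsGalleryList f B' l₁ ∧ w.Nodup ∧ (∀ i, i ∈ w ↔ i ∈ B ∧ i ∉ B') ∧
      ∀ p, p <+: w → Realizable f B {i | i ∈ B' ∨ i ∈ p} := by
  have hpw : l.Pairwise fun a b => a ∉ B' → b ∉ B' := by
    refine hl.nodup.pairwise_before.imp_of_mem fun {a b} ha hb hab ha' hb' => ?_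
    exact hab.asymm (hfirst b hb' a ((hl.mem_iff a).1 ha) ha')
  obtain ⟨l₁, w, rfl, h1, h2⟩ := hpw.exists_split
  simp only [not_not] at h1
  obtain ⟨n1, n2, hdis⟩ := List.nodup_append'.1 hl.nodup
  have hl₁ : ∀ i, i ∈ l₁ ↔ i ∈ B' := by
    refine fun i => ⟨h1 i, fun hi => ?_⟩
    have := (hl.mem_iff i).2 (h.subset hi)
    rcases List.mem_append.1 this with h' | h'
    · exact h'
    · exact absurd hi (h2 i h')
  refine ⟨l₁, w, rfl, ⟨n1, hl₁, ?_⟩, n2, ?_, ?_⟩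
  · exact fun p hp => (hl.realizable p (hp.trans (List.prefix_append _ _))).mono h.subset
  · intro i
    refine ⟨fun hi => ⟨(hl.mem_iff i).1 (List.mem_append_right _ hi), h2 i hi⟩, ?_⟩
    rintro ⟨hi, hi'⟩
    simpa [hl₁, hi'] using (hl.mem_iff i).2 hi
  · intro p hp
    refine (hl.realizable (l₁ ++ p) (by simpa using hp)).congr fun i _ => ?_
    simp [hl₁]

/-- Reversing the crossings of the hyperplanes through a codimension two face of the gallery. -/
theorem IsGalleryList.reverse_block {q m s : List ι} {k : ι}
    (hl : IsGalleryList f B (q ++ (m ++ [k]) ++ s)) {y : V} (hq : ∀ i ∈ q, f i y < 0)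
    (hs : ∀ i ∈ s, 0 < f i y) (hm : ∀ i ∈ m, f i y = 0) (hk : f k y = 0) :
    IsGalleryList f B (q ++ (k :: m.reverse) ++ s) := by
  have hperm : (q ++ (k :: m.reverse) ++ s).Perm (q ++ (m ++ [k]) ++ s) := by
    refine List.Perm.append_right _ (List.Perm.append_left _ ?_)
    simpa using (m ++ [k]).reverse_perm
  refine ⟨hperm.nodup_iff.2 hl.nodup, fun i => by rw [hperm.mem_iff, hl.mem_iff], ?_⟩
  intro p hp
  rcases hp.cases_append with hp | ⟨s₁, rfl, hs₁⟩
  · rcases hp.cases_append with hp | ⟨m', rfl, hm'⟩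
    · exact hl.realizable p (hp.trans (by simp))
    rcases hm'.cases_cons with rfl | ⟨m₁, rfl, m₂, hm₁⟩
    · exact hl.realizable _ (by simp)
    have hme : m = m₂.reverse ++ m₁.reverse := by
      rw [← List.reverse_append, hm₁, List.reverse_reverse]
    -- `y - ε • z` keeps the signs of `y` off the block and reverses those of `z` on it. As `z` is
    -- negative exactly on the part `m₂` of the block, the new negative part is `k :: m₁`.
    obtain ⟨z, hz⟩ := hl.realizable (q ++ m₂.reverse) (by rw [hme]; simp)
    obtain ⟨ε, hε, he⟩ := exists_perturbation B (fun i => f i y) (fun i => - f i z)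
    have hnd := hl.nodup
    rw [hme] at hnd
    refine ⟨y - ε • z, fun i hi => ?_⟩
    have hz' := hz i hi
    have he' := he i hi
    have hil := (hl.mem_iff i).2 hi
    rw [hme] at hil
    have hval : f i (y - ε • z) = f i y + ε * - f i z := by simp [sub_eq_add_neg]
    rw [hval]
    simp only [Set.mem_ofPred_eq, List.mem_append, List.mem_cons, List.mem_reverse,
      List.not_mem_nil, or_false] at hz' hil ⊢
    simp only [List.nodup_append', List.disjoint_left, List.mem_append, List.mem_reverse,
      List.mem_singleton] at hnd
    rcases hil with (hiq | (him | him) | rfl) | his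
    · have := he'.1 (hq i hiq)
      exact ⟨fun _ => this, fun h => absurd (Or.inl hiq) h⟩
    · have h0 := hm i (by simp [hme, him])
      have hneg := hz'.1 (Or.inr him)
      have hni : ¬ (i ∈ q ∨ i = k ∨ i ∈ m₁) := by
        rintro (h | rfl | h)
        · exact hnd.1.2.2 h (by simp [him])
        · exact hnd.1.2.1.2.2 (Or.inl him) rfl
        · exact hnd.1.2.1.1.2.2 him h
      refine ⟨fun h => absurd h hni, fun _ => ?_⟩
      rw [h0, zero_add]
      exact mul_pos hε (neg_pos.2 hneg)
    · have h0 := hm i (by simp [hme, him])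
      have hni : ¬ (i ∈ q ∨ i ∈ m₂) := by
        rintro (h | h)
        · exact hnd.1.2.2 h (by simp [him])
        · exact hnd.1.2.1.1.2.2 h him
      have hpos := hz'.2 hni
      refine ⟨fun _ => ?_, fun h => absurd (Or.inr (Or.inr him)) h⟩
      rw [h0, zero_add]
      exact mul_neg_of_pos_of_neg hε (neg_neg_iff_pos.2 hpos)
    · have hni : ¬ (i ∈ q ∨ i ∈ m₂) := by
        rintro (h | h)
        · exact hnd.1.2.2 h (by simp)
        · exact hnd.1.2.1.2.2 (Or.inl h) rfl
      have hpos := hz'.2 hni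
      refine ⟨fun _ => ?_, fun h => absurd (Or.inr (Or.inl rfl)) h⟩
      rw [hk, zero_add]
      exact mul_neg_of_pos_of_neg hε (neg_neg_iff_pos.2 hpos)
    · have hni : ¬ (i ∈ q ∨ i = k ∨ i ∈ m₁) := by
        intro h
        refine hnd.2.2 ?_ his
        tauto
      exact ⟨fun h => absurd h hni, fun _ => he'.2 (hs i his)⟩
  · refine (hl.realizable (q ++ (m ++ [k]) ++ s₁) (by simpa using hs₁)).congr fun i _ => ?_
    simp
    tauto

/-- A gallery of `B` that does not cross `B'` first can be flipped at a codimension two flat, so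
that a hyperplane of `B'` gets crossed before the others through this flat. -/
theorem IsModularStep.exists_flip [DecidableEq ι] (h : IsModularStep f B' B v) {l : List ι}
    (hl : IsGalleryList f B l) (hnot : ¬ ∀ k ∈ B', ∀ i ∈ B, i ∉ B' → l.Before k i) :
    ∃ l' g k, IsGalleryList f B l' ∧ k ∈ B' ∧ g ∈ B ∧ g ∉ B' ∧ l.Before g k ∧ l'.Before k g ∧
      ∀ a b, l.Before a b → l'.Before a b ∨
        ((∃ α β : ℝ, f a = α • f g + β • f k) ∧ ∃ α β : ℝ, f b = α • f g + β • f k) := by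
  push Not at hnot
  obtain ⟨k₁, hk₁, i₁, hi₁, hi₁', hnb⟩ := hnot
  have hbef : l.Before i₁ k₁ :=
    (List.before_or_before ((hl.mem_iff _).2 hi₁) (by rintro rfl; exact hi₁' hk₁)).resolve_right hnb
  obtain ⟨p, u, k, s, rfl, hu, hp, hu', hk⟩ := List.exists_blocks (· ∈ B') hbef
    ((hl.mem_iff _).2 (h.subset hk₁)) hi₁' hk₁
  obtain ⟨t, g, rfl⟩ := List.eq_nil_or_concat u |>.resolve_left hu
  simp only [List.concat_eq_append] at *
  set u := t ++ [g] with hudef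
  have hgu : g ∈ u := by simp [hudef]
  have huB : ∀ i ∈ u, i ∈ B := fun i hi => (hl.mem_iff i).1 (by simp [hi])
  have hkB := h.subset hk
  have hnd := hl.nodup
  simp only [List.nodup_append', List.disjoint_left, List.mem_append, List.nodup_cons] at hnd
  obtain ⟨⟨hpn, hun, hpu⟩, ⟨hks, hsn⟩, hpus⟩ := hnd
  -- a point on the wall crossed after `p ++ u`
  obtain ⟨x, hx⟩ := hl.realizable (p ++ u) (by simp)
  obtain ⟨x', hx'⟩ := hl.realizable (p ++ u ++ [k]) (by simp)
  have hkx : 0 < f k x := (hx k hkB).2 fun hmem => hpus (List.mem_append.1 hmem) (by simp)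
  have hkx' : f k x' < 0 := (hx' k hkB).1 (by simp)
  obtain ⟨y, hyk, hyneg, hypos⟩ : ∃ y, f k y = 0 ∧ (∀ i ∈ p ++ u, f i y < 0) ∧
      ∀ i ∈ s, 0 < f i y := by
    refine ⟨(- f k x') • x + f k x • x', ?_, ?_, ?_⟩
    · simp; ring
    · intro i hi
      have hiB : i ∈ B := (hl.mem_iff i).1 (List.mem_append_left _ hi)
      have h1 := (hx i hiB).1 hi
      have h2 := (hx' i hiB).1 (List.mem_append_left _ hi)
      simp only [map_add, map_smul, smul_eq_mul]
      nlinarith [mul_pos (neg_pos.2 hkx') (neg_pos.2 h1), mul_pos hkx (neg_pos.2 h2)]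
    · intro i hi
      have hiB : i ∈ B := (hl.mem_iff i).1 (by simp [hi])
      have hni : i ∉ p ++ u := fun h => hpus (List.mem_append.1 h) (List.mem_cons_of_mem _ hi)
      have hik : i ≠ k := fun h => hks (h ▸ hi)
      have h1 := (hx i hiB).2 hni
      have h2 := (hx' i hiB).2 (by
        simp only [Set.mem_ofPred_eq, List.mem_append, List.mem_singleton] at hni ⊢
        tauto)
      simp only [map_add, map_smul, smul_eq_mul]
      nlinarith [mul_pos (neg_pos.2 hkx') h1, mul_pos hkx h2]
  have hgB := huB g hgu
  have hgv : 0 < f g v := h.pos g hgB (hu' g hgu)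
  have hgy : f g y < 0 := hyneg g (by simp [hgu])
  -- comparison of two members of `u` at `y`
  have hcomp : ∀ i ∈ u, ∀ j ∈ u, u.Before i j →
      f j v * f i y - f i v * f j y < 0 ∨ ∃ c : ℝ, c ≠ 0 ∧ f j v • f i - f i v • f j = c • f k := by
    intro i hi j hj hij
    have hne : i ≠ j := by
      rintro rfl
      exact hij.asymm hij
    obtain ⟨k', hk', c, hc, e⟩ :=
      h.modular i (huB i hi) (hu' i hi) j (huB j hj) (hu' j hj) hne
    by_cases hkk : k' = k
    · subst hkk
      exact Or.inr ⟨c, hc, e⟩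
    left
    -- At `z`, reached after `i` but before `j`, the combination is negative. Since `k'` lies in `p`
    -- or in `s`, `f k'` has the same sign at `y` as at `z`, so the combination is negative at `y`
    -- too.
    obtain ⟨r, hr, hir, hjr⟩ := List.before_iff_prefix.1 hij
    obtain ⟨z, hz⟩ := hl.realizable (p ++ r) (by
      rw [List.append_assoc]
      exact (List.prefix_append_right_inj p).2 (hr.trans (List.prefix_append _ _)))
    have e' : ∀ x, f j v * f i x - f i v * f j x = c * f k' x := fun x => by
      have := congrArg (fun g : Module.Dual ℝ V => g x) e
      simpa using this
    have hiz : f i z < 0 := (hz i (huB i hi)).1 (by simp [hir])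
    have hjz : 0 < f j z := (hz j (huB j hj)).2 (by
      simp only [Set.mem_ofPred_eq, List.mem_append, not_or]
      exact ⟨fun h => hpu h hj, hjr⟩)
    have hneg : c * f k' z < 0 := by
      rw [← e']
      have := mul_pos (h.pos j (huB j hj) (hu' j hj)) (neg_pos.2 hiz)
      have := mul_pos (h.pos i (huB i hi) (hu' i hi)) hjz
      linarith
    rw [e']
    have hk'B := h.subset hk'
    have hk'u : k' ∉ u := fun h => hu' k' h hk'
    by_cases hk'p : k' ∈ p
    · have h1 : f k' z < 0 := (hz k' hk'B).1 (by simp [hk'p])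
      have h2 : f k' y < 0 := hyneg k' (by simp [hk'p])
      have hc0 : 0 < c := by
        by_contra hcon
        nlinarith
      exact mul_neg_of_pos_of_neg hc0 h2
    · have h1 : 0 < f k' z := (hz k' hk'B).2 (by
        simp only [Set.mem_ofPred_eq, List.mem_append, not_or]
        exact ⟨hk'p, fun h => hk'u (hr.subset h)⟩)
      have h2 : 0 < f k' y := hypos k' (by
        have := (hl.mem_iff k').2 hk'B
        simpa [hk'p, hk'u, hkk] using this)
      have hc0 : c < 0 := by
        by_contra hcon
        nlinarith
      exact mul_neg_of_neg_of_pos hc0 h2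
  let G : ι → Prop := fun i => ∃ α β : ℝ, f i = α • f g + β • f k
  have hGg : G g := ⟨1, 0, by simp⟩
  have hGk : G k := ⟨0, 1, by simp⟩
  -- the point of the codimension two flat
  let y' := f g v • y - f g y • v
  have hval : ∀ i, f i y' = f g v * f i y - f g y * f i v := fun i => by simp [y']
  have hk0 : f k y' = 0 := by rw [hval, hyk, h.zero k hk]; ring
  have hG0 : ∀ i, G i → f i y' = 0 := by
    rintro i ⟨α, β, e⟩
    have : f g y' = 0 := by rw [hval]; ring
    rw [e]
    simp [this, hk0]
  have hlast : ∀ i ∈ u, i ≠ g → u.Before i g := by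
    intro i hi hig
    refine List.before_append_left (by simpa [hudef, hig] using hi) fun hgt => ?_
    rw [hudef] at hun
    exact (List.nodup_append'.1 hun).2.2 hgt (by simp)
  have hneg' : ∀ j ∈ u, ¬ G j → f j y' < 0 := by
    intro j hj hGj
    have hjg : j ≠ g := fun h => hGj (h ▸ hGg)
    rcases hcomp j hj g hgu (hlast j hj hjg) with h1 | ⟨c, -, e⟩
    · rw [hval]
      linarith
    · refine absurd ⟨(f g v)⁻¹ * f j v, (f g v)⁻¹ * c, ?_⟩ hGj
      rw [mul_smul, mul_smul, ← e, ← smul_add, add_sub_cancel, smul_smul, inv_mul_cancel₀ hgv.ne',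
        one_smul]
  -- The first alternative of `hcomp` says that the ratio `f i y / f i v` increases strictly from
  -- `i` to `j`. Members of `u` through the flat have the ratio of `g`, so a later one off the flat
  -- would exceed it, against `hneg'`. In the second alternative `j` itself passes through the flat.
  have hsplit : u.Pairwise fun a b => G a → G b := by
    refine hun.pairwise_before.imp_of_mem fun {i j} hi hj hij hGi => ?_
    by_contra hGj
    have hjneg := hneg' j hj hGj
    have hi0 := hG0 i hGi
    have hiv := h.pos i (huB i hi) (hu' i hi)
    have hjv := h.pos j (huB j hj) (hu' j hj)
    rw [hval] at hjneg hi0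
    rcases hcomp i hi j hj hij with h1 | ⟨c, -, e⟩
    · have e1 : f g v * (f j v * f i y - f i v * f j y)
          = f j v * (f g v * f i y - f g y * f i v) - f i v * (f g v * f j y - f g y * f j v) := by
        ring
      rw [hi0] at e1
      nlinarith [mul_pos hgv (neg_pos.2 h1), mul_pos hiv (neg_pos.2 hjneg)]
    · obtain ⟨α, β, e1⟩ := hGi
      refine hGj ⟨(f i v)⁻¹ * (f j v * α), (f i v)⁻¹ * (f j v * β - c), ?_⟩
      have e2 : f i v • f j = f j v • (α • f g + β • f k) - c • f k := by
        refine Eq.trans ?_ (congrArg (fun φ => f j v • φ - c • f k) e1)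
        simp only [← e]
        abel
      generalize f i v = A at hiv e2 ⊢
      have e3 : f j = A⁻¹ • (A • f j) := by rw [smul_smul, inv_mul_cancel₀ hiv.ne', one_smul]
      generalize f j v = C at e2 ⊢
      rw [e3, e2]
      module
  obtain ⟨u₁, m, hum, hu₁, hm⟩ := hsplit.exists_split
  have hgm : g ∈ m := by
    rw [hum] at hgu
    rcases List.mem_append.1 hgu with h' | h'
    · exact absurd hGg (hu₁ g h')
    · exact h'
  have hleq : p ++ u ++ k :: s = (p ++ u₁) ++ (m ++ [k]) ++ s := by simp [hum]
  have hq : ∀ i ∈ p ++ u₁, f i y' < 0 := by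
    intro i hi
    rcases List.mem_append.1 hi with hi | hi
    · rw [hval, h.zero i (hp i hi)]
      have := mul_pos hgv (neg_pos.2 (hyneg i (by simp [hi])))
      linarith
    · exact hneg' i (by simp [hum, hi]) (hu₁ i hi)
  have hs' : ∀ i ∈ s, 0 < f i y' := by
    intro i hi
    have h1 := mul_pos hgv (hypos i hi)
    rw [hval]
    by_cases hiB' : i ∈ B'
    · rw [h.zero i hiB']
      linarith
    · have h2 := mul_pos (neg_pos.2 hgy) (h.pos i ((hl.mem_iff i).1 (by simp [hi])) hiB')
      linarith
  have hl2 := hl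
  rw [hleq] at hl2
  have hflip := hl2.reverse_block hq hs' (fun i hi => hG0 i (hm i hi)) hk0
  have hkg : k ≠ g := fun h => hu' g hgu (h ▸ hk)
  refine ⟨_, g, k, hflip, hk, hgB, hu' g hgu, ?_, ?_, ?_⟩
  · refine List.before_append_left (by simp [hgu]) fun hmem => ?_
    exact hpus (List.mem_append.1 hmem) (by simp)
  · have hgp : g ∉ p := fun h => hpu h hgu
    have hgu₁ : g ∉ u₁ := fun h => hu₁ g h hGg
    have : (p ++ u₁ ++ k :: m.reverse ++ s) = (p ++ u₁ ++ [k]) ++ (m.reverse ++ s) := by simp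
    rw [this]
    exact List.before_append_left (by simp) (by simp [hgp, hgu₁, hkg.symm])
  · intro a b hab
    rw [hleq] at hab
    rcases hab.rearrange (m' := k :: m.reverse) (by simp [or_comm]) with h1 | ⟨h1, h2⟩
    · exact Or.inl h1
    · have hmk : ∀ i ∈ m ++ [k], G i := by
        intro i hi
        rcases List.mem_append.1 hi with hi | hi
        · exact hm i hi
        · rw [List.mem_singleton.1 hi]
          exact hGk
      exact Or.inr ⟨hmk a h1, hmk b h2⟩

end Modular

/-! ### Induction along the flag. -/

section Tower

variable {V : Type*} [AddCommGroup V] [Module ℝ V] {ι : Type*}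

theorem exists_level {Bs : ℕ → Finset ι} {n : ℕ} (hn : Bs n = ∅) {a : ι} (ha : a ∈ Bs 0) :
    ∃ i, a ∈ Bs i ∧ a ∉ Bs (i + 1) := by
  by_contra! h
  have : ∀ i, a ∈ Bs i := fun i => Nat.rec ha (fun i hi => h i hi) i
  simpa [hn] using this n

variable [DecidableEq ι]

/-- The list `l` enumerates each `Bs (i + 1)`, `m ≤ i`, before the rest of `Bs i`. -/
def IsTowerIncident (Bs : ℕ → Finset ι) (m : ℕ) (l : List ι) : Prop :=
  ∀ i, m ≤ i → ∀ a ∈ Bs (i + 1), ∀ b ∈ Bs i, b ∉ Bs (i + 1) → l.Before a b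

variable {f : ι → Module.Dual ℝ V} {Bs : ℕ → Finset ι} {vs : ℕ → V}

/-- Built backwards from the empty stage: a gallery of `Bs (m + 1)` is followed by the crossings of
the line `-x₀ + ℝ v` with the rest of `Bs m`. -/
theorem exists_incident_gallery (hstep : ∀ m, IsModularStep f (Bs (m + 1)) (Bs m) (vs m)) {x₀ : V} :
    ∀ n m, Bs (m + n) = ∅ → (∀ i ∈ Bs m, 0 < f i x₀) →
      ∃ l, IsGalleryList f (Bs m) l ∧ IsTowerIncident Bs m l := by
  have hanti : Antitone Bs := antitone_nat_of_succ_le fun m => (hstep m).subset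
  intro n
  induction n with
  | zero =>
    intro m hm _
    have hm : Bs m = ∅ := hm
    refine ⟨[], ⟨by simp, by simp [hm], fun p _ => ⟨0, by simp [hm]⟩⟩, ?_⟩
    intro i hi a ha
    have := hanti (Nat.le_succ_of_le hi) ha
    simp [hm] at this
  | succ n ih =>
    intro m hm hpos
    obtain ⟨l, hl, hinc⟩ := ih (m + 1) (by rw [← hm]; congr 1; ring)
      fun i hi => hpos i ((hstep m).subset hi)
    obtain ⟨w, hw, hmem, hreal⟩ := (hstep m).exists_enumeration hpos
    refine ⟨l ++ w, (hstep m).append_gallery hl hw hmem hreal, ?_⟩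
    intro i hi a ha b hb hb'
    rcases Nat.eq_or_lt_of_le hi with rfl | hi
    · exact List.before_append_left ((hl.mem_iff a).2 ha) fun h => hb' ((hl.mem_iff b).1 h)
    · exact List.before_append_of_before (hinc i hi a ha b hb hb')

/-- Incidence orders hyperplanes of different levels. For two of the same level, modularity puts
some `k` of the next stage in their pencil; both lists cross `k` before `a`, and this fixes the
order of the pencil. -/
theorem IsTowerIncident.eq (hstep : ∀ m, IsModularStep f (Bs (m + 1)) (Bs m) (vs m)) {x₀ : V}
    (hpos : IsPositiveSystem f (Bs 0) x₀) {n : ℕ} (hn : Bs n = ∅) {l l' : List ι}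
    (hl : IsGalleryList f (Bs 0) l) (hl' : IsGalleryList f (Bs 0) l')
    (hinc : IsTowerIncident Bs 0 l) (hinc' : IsTowerIncident Bs 0 l') : l = l' := by
  have hanti : Antitone Bs := antitone_nat_of_succ_le fun m => (hstep m).subset
  refine List.eq_of_before_imp hl.nodup hl'.nodup (fun a => by rw [hl.mem_iff, hl'.mem_iff]) ?_
  intro a ha b hb hab
  rw [hl.mem_iff] at ha hb
  have hne : a ≠ b := by
    rintro rfl
    exact hab.asymm hab
  obtain ⟨i, hai, hai'⟩ := exists_level hn ha
  obtain ⟨j, hbj, hbj'⟩ := exists_level hn hb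
  rcases lt_trichotomy i j with hij | rfl | hij
  · exact absurd hab (hinc i (Nat.zero_le _) b (hanti hij hbj) a hai hai').asymm
  · obtain ⟨k, hk, c, hc, e⟩ := (hstep i).modular a hai hai' b hbj hbj' hne
    have hk0 := hanti (Nat.zero_le _) hk
    have hav := (hstep i).pos a hai hai'
    have hka : k ≠ a := fun h => hai' (h ▸ hk)
    refine (IsGalleryList.before_iff_of_coplanar hpos hl hl' hk0 ha hka
      (hinc i (Nat.zero_le _) k hk a hai hai') (hinc' i (Nat.zero_le _) k hk a hai hai') ha hb
      ⟨0, 1, by simp⟩ ?_).1 hab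
    refine ⟨-((f a (vs i))⁻¹ * c), (f a (vs i))⁻¹ * f b (vs i), ?_⟩
    generalize f a (vs i) = A at hav e ⊢
    generalize f b (vs i) = C at e ⊢
    have e3 : f b = A⁻¹ • (A • f b) := by rw [smul_smul, inv_mul_cancel₀ hav.ne', one_smul]
    have e2 : A • f b = C • f a - c • f k := by rw [← e]; abel
    rw [e3, e2]
    module
  · exact hinc' j (Nat.zero_le _) a (hanti hij hai) b hbj hbj'

/-- A gallery that is not incident to the tower can be flipped at a codimension two flat that
separates it from the incident ones. -/
theorem exists_tower_flip (hstep : ∀ m, IsModularStep f (Bs (m + 1)) (Bs m) (vs m)) :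
    ∀ n m, Bs (m + n) = ∅ → ∀ l, IsGalleryList f (Bs m) l → ¬ IsTowerIncident Bs m l →
      ∃ l' g k, IsGalleryList f (Bs m) l' ∧
        (∃ j, m ≤ j ∧ k ∈ Bs (j + 1) ∧ g ∈ Bs j ∧ g ∉ Bs (j + 1)) ∧
        l.Before g k ∧ l'.Before k g ∧
        ∀ a b, l.Before a b → l'.Before a b ∨
          ((∃ α β : ℝ, f a = α • f g + β • f k) ∧ ∃ α β : ℝ, f b = α • f g + β • f k) := by
  have hanti : Antitone Bs := antitone_nat_of_succ_le fun m => (hstep m).subset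
  intro n
  induction n with
  | zero =>
    intro m hm l _ hnot
    refine absurd ?_ hnot
    intro i hi a ha
    have hm : Bs m = ∅ := hm
    have := hanti (Nat.le_succ_of_le hi) ha
    simp [hm] at this
  | succ n ih =>
    intro m hm l hl hnot
    by_cases hfirst : ∀ k ∈ Bs (m + 1), ∀ i ∈ Bs m, i ∉ Bs (m + 1) → l.Before k i
    -- Initial segments reaching into `w` see only the set `Bs (m + 1)`, not its order, so a flip of
    -- `l₁` can be followed by the same `w`.
    · obtain ⟨l₁, w, rfl, hl₁, hw, hmem, hreal⟩ := (hstep m).split_gallery hl hfirst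
      have hnot₁ : ¬ IsTowerIncident Bs (m + 1) l₁ := by
        refine fun hinc => hnot fun i hi a ha b hb hb' => ?_
        rcases Nat.eq_or_lt_of_le hi with rfl | hi
        · exact hfirst a ha b hb hb'
        · exact List.before_append_of_before (hinc i hi a ha b hb hb')
      obtain ⟨l', g, k, hl', ⟨j, hj, hk, hg, hg'⟩, h1, h2, h3⟩ :=
        ih (m + 1) (by rw [← hm]; congr 1; ring) l₁ hl₁ hnot₁
      refine ⟨l' ++ w, g, k, (hstep m).append_gallery hl' hw hmem hreal,
        ⟨j, by omega, hk, hg, hg'⟩, List.before_append_of_before h1,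
        List.before_append_of_before h2, ?_⟩
      intro a b hab
      have hab' : ([] ++ l₁ ++ w).Before a b := hab
      rcases hab'.rearrange (m' := l') (fun i => by rw [hl₁.mem_iff, hl'.mem_iff]) with h | ⟨ha, hb⟩
      · exact Or.inl h
      · have : l₁.Before a b := by
          unfold List.Before at hab ⊢
          rwa [List.idxOf_append_of_mem ha, List.idxOf_append_of_mem hb] at hab
        exact (h3 a b this).imp_left List.before_append_of_before
    · obtain ⟨l', g, k, hl', hk, hg, hg', h⟩ := (hstep m).exists_flip hl hfirst
      exact ⟨l', g, k, hl', ⟨m, le_rfl, hk, hg, hg'⟩, h⟩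

end Tower

/-! ### Sequences of negative sets and their traces. -/

section PrefixSets

variable {ι : Type*}

/-- The sets obtained from `T` by inserting the entries of a list one after the other. -/
def prefixSets (T : Set ι) : List ι → List (Set ι)
  | [] => [T]
  | a :: l => T :: prefixSets (insert a T) l

theorem prefixSets_eq_cons (T : Set ι) (l : List ι) : ∃ t, prefixSets T l = T :: t := by
  cases l <;> exact ⟨_, rfl⟩

/-- Every inserted entry is new, so it is recovered by comparing consecutive sets. -/
theorem prefixSets_inj {l l' : List ι} {T : Set ι} (hl : l.Nodup) (hl' : l'.Nodup)
    (hT : ∀ a ∈ l, a ∉ T) (hT' : ∀ a ∈ l', a ∉ T) (h : prefixSets T l = prefixSets T l') :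
    l = l' := by
  induction l generalizing T l' with
  | nil =>
    cases l' with
    | nil => rfl
    | cons b l' =>
      obtain ⟨t, ht⟩ := prefixSets_eq_cons (insert b T) l'
      simp [prefixSets, ht] at h
  | cons a l ih =>
    cases l' with
    | nil =>
      obtain ⟨t, ht⟩ := prefixSets_eq_cons (insert a T) l
      simp [prefixSets, ht] at h
    | cons b l' =>
      rw [prefixSets, prefixSets, List.cons.injEq] at h
      obtain ⟨t, ht⟩ := prefixSets_eq_cons (insert a T) l
      obtain ⟨t', ht'⟩ := prefixSets_eq_cons (insert b T) l'
      have h2 := h.2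
      rw [ht, ht', List.cons.injEq] at h2
      have hab : a = b := by
        have : a ∈ insert b T := h2.1 ▸ Set.mem_insert a T
        exact this.resolve_right (hT a (by simp))
      subst hab
      rw [List.nodup_cons] at hl hl'
      rw [ih hl.2 hl'.2 ?_ ?_ h.2]
      · intro c hc
        rw [Set.mem_insert_iff, not_or]
        exact ⟨fun h => hl.1 (h ▸ hc), hT c (by simp [hc])⟩
      · intro c hc
        rw [Set.mem_insert_iff, not_or]
        exact ⟨fun h => hl'.1 (h ▸ hc), hT' c (by simp [hc])⟩

/-- Inserting an entry outside `P` repeats the trace on `P` and is erased; inserting one of `P`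
always changes the trace. -/
theorem destutter_map_prefixSets [DecidableRel fun s t : Set ι => s ≠ t] (P : Set ι)
    [DecidablePred (· ∈ P)] {l : List ι} {T : Set ι} (hl : l.Nodup) (hT : ∀ a ∈ l, a ∉ T) :
    ((prefixSets T l).map (· ∩ P)).destutter (fun s t => s ≠ t) =
      prefixSets (T ∩ P) (l.filter (· ∈ P)) := by
  induction l generalizing T with
  | nil => simp [prefixSets]
  | cons a l ih =>
    rw [List.nodup_cons] at hl
    have ih' := @ih (insert a T) hl.2 (by
      intro c hc
      rw [Set.mem_insert_iff, not_or]
      exact ⟨fun h => hl.1 (h ▸ hc), hT c (by simp [hc])⟩)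
    obtain ⟨t, ht⟩ := prefixSets_eq_cons (insert a T) l
    rw [prefixSets, ht, List.map_cons, List.map_cons, List.destutter_cons_cons]
    rw [ht, List.map_cons, List.destutter_cons'] at ih'
    by_cases ha : a ∈ P
    · have hins : insert a T ∩ P = insert a (T ∩ P) := Set.insert_inter_of_mem ha
      have hne : T ∩ P ≠ insert a T ∩ P := by
        intro h
        have : a ∈ T ∩ P := by rw [h, hins]; exact Set.mem_insert _ _
        exact hT a (by simp) this.1
      rw [if_pos hne, ih', List.filter_cons_of_pos (by simpa using ha), prefixSets, hins]
    · have hins : insert a T ∩ P = T ∩ P := Set.insert_inter_of_notMem ha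
      rw [if_neg (by simp [hins]), List.filter_cons_of_neg (by simpa using ha), ← hins, ih']

theorem List.Before.filter [DecidableEq ι] {l : List ι} {a b : ι} (P : ι → Bool) (ha : P a)
    (h : l.Before a b) : (l.filter P).Before a b := by
  obtain ⟨p, hp, hap, hbp⟩ := List.before_iff_prefix.1 h
  exact List.before_iff_prefix.2 ⟨p.filter P, hp.filter P, List.mem_filter.2 ⟨hap, ha⟩,
    fun h => hbp (List.mem_filter.1 h).1⟩

theorem List.before_filter_iff [DecidableEq ι] {l : List ι} {a b : ι} {P : ι → Bool} (ha : P a)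
    (hb : P b) (hal : a ∈ l) : (l.filter P).Before a b ↔ l.Before a b := by
  refine ⟨fun h => ?_, fun h => h.filter P ha⟩
  have hne : a ≠ b := by
    rintro rfl
    exact h.asymm h
  exact (List.before_or_before hal hne).resolve_right fun h' => (h'.filter P hb).asymm h

theorem List.filter_eq_filter_iff_before [DecidableEq ι] {l l' : List ι} (hl : l.Nodup)
    (hl' : l'.Nodup) (hmem : ∀ a, a ∈ l ↔ a ∈ l') (P : ι → Bool) :
    l.filter P = l'.filter P ↔
      ∀ a ∈ l, ∀ b ∈ l, P a → P b → l.Before a b → l'.Before a b := by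
  constructor
  · intro h a ha b _ hPa hPb hab
    rw [← List.before_filter_iff hPa hPb ((hmem a).1 ha), ← h]
    exact hab.filter P hPa
  · intro h
    refine List.eq_of_before_imp (hl.filter P) (hl'.filter P) (by simp [hmem]) ?_
    intro a ha b hb hab
    rw [List.mem_filter] at ha hb
    exact (h a ha.1 b hb.1 ha.2 hb.2 ((List.before_filter_iff ha.2 hb.2 ha.1).1 hab)).filter P ha.2

end PrefixSets

namespace Arrangement

/-! ### Chambers as sign patterns. -/

section Signs

variable {V : Type u} [AddCommGroup V] [Module ℝ V] [TopologicalSpace V] {A : Arrangement V}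

theorem Chamber.isPreconnected (c : A.Chamber) : IsPreconnected c.1 := by
  obtain ⟨_, y, hy, rfl⟩ := c
  exact isPreconnected_connectedComponentIn

theorem Chamber.neg_of_neg (c : A.Chamber) {g : V → ℝ} (hg : Continuous g)
    (h0 : ∀ x ∈ c.1, g x ≠ 0) {x y : V} (hx : x ∈ c.1) (hy : y ∈ c.1) (h : g x < 0) : g y < 0 := by
  by_contra hcon
  have := (c.isPreconnected.image g hg.continuousOn).Icc_subset (Set.mem_image_of_mem g hx)
    (Set.mem_image_of_mem g hy) (show (0 : ℝ) ∈ Set.Icc (g x) (g y) from ⟨h.le, not_lt.1 hcon⟩)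
  obtain ⟨z, hz, hz0⟩ := this
  exact h0 z hz hz0

theorem Chamber.ne_zero (c : A.Chamber) {H : Submodule ℝ V} (hH : H ∈ A.hyperplanes)
    {g : V →ₗ[ℝ] ℝ} (hg : LinearMap.ker g = H) : ∀ x ∈ c.1, g x ≠ 0 := by
  intro x hx h0
  refine c.subset_complement hx H hH ?_
  rw [← hg]
  exact h0

/-- Open half-spaces are convex, so the segment from `x` to `x'` avoids every hyperplane and stays
in one component. -/
theorem Chamber.eq_of_signs [IsTopologicalAddGroup V] [ContinuousSMul ℝ V] {c c' : A.Chamber}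
    {x x' : V} (hx : x ∈ c.1) (hx' : x' ∈ c'.1)
    (h : ∀ H ∈ A.hyperplanes, ∃ g : V →ₗ[ℝ] ℝ, LinearMap.ker g = H ∧ (g x < 0 ↔ g x' < 0)) :
    c = c' := by
  have hseg : segment ℝ x x' ⊆ A.complement := by
    rintro z ⟨a, b, ha, hb, hab, rfl⟩ H hH hz
    obtain ⟨g, hg, hs⟩ := h H hH
    have h1 := c.ne_zero hH hg x hx
    have h2 := c'.ne_zero hH hg x' hx'
    rw [← hg, LinearMap.mem_ker] at hz
    simp only [map_add, map_smul, smul_eq_mul] at hz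
    rcases lt_or_gt_of_ne h1 with h1 | h1
    · have h2 := hs.1 h1
      rcases ha.eq_or_lt with rfl | ha
      · have : b = 1 := by linarith
        subst this
        linarith
      · nlinarith [mul_pos ha (neg_pos.2 h1), mul_nonneg hb (neg_pos.2 h2).le]
    · have h2 : 0 < g x' := lt_of_le_of_ne (not_lt.1 fun h' => absurd (hs.2 h') h1.not_gt) h2.symm
      rcases ha.eq_or_lt with rfl | ha
      · have : b = 1 := by linarith
        subst this
        linarith
      · nlinarith [mul_pos ha h1, mul_nonneg hb h2.le]
  have hmem : x' ∈ connectedComponentIn A.complement x :=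
    (convex_segment x x').isPreconnected.subset_connectedComponentIn (left_mem_segment ℝ x x') hseg
      (right_mem_segment ℝ x x')
  obtain ⟨_, y, hy, rfl⟩ := c
  obtain ⟨_, y', hy', rfl⟩ := c'
  apply Subtype.ext
  change connectedComponentIn _ y = connectedComponentIn _ y'
  rw [connectedComponentIn_eq hx, connectedComponentIn_eq hx', connectedComponentIn_eq hmem]

/-- The hyperplanes of `A` on whose negative side, with respect to the functionals `f H`, the
chamber lies. -/
def negSet (f : Submodule ℝ V → Module.Dual ℝ V) (c : A.Chamber) : Set (Submodule ℝ V) :=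
  {H ∈ A.hyperplanes | ∀ x ∈ c.1, f H x < 0}

/-- A choice of defining functionals of the hyperplanes of `A` that are positive on `c₀`. -/
structure IsCoorientation (c₀ : A.Chamber) (f : Submodule ℝ V → Module.Dual ℝ V) : Prop where
  ker_eq : ∀ H ∈ A.hyperplanes, LinearMap.ker (f H) = H
  pos : ∀ H ∈ A.hyperplanes, ∀ x ∈ c₀.1, 0 < f H x

variable {c₀ : A.Chamber} {f : Submodule ℝ V → Module.Dual ℝ V}

theorem IsCoorientation.negSet_base (hf : IsCoorientation c₀ f) : negSet f c₀ = ∅ := by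
  ext H
  simp only [Set.mem_empty_iff_false, iff_false]
  intro h
  obtain ⟨x, hx⟩ := c₀.exists_mem
  exact lt_asymm (h.2 x hx) (hf.pos H h.1 x hx)

theorem IsCoorientation.negSet_neg_base [IsTopologicalAddGroup V] (hf : IsCoorientation c₀ f) :
    negSet f (-c₀) = A.hyperplanes := by
  ext H
  refine ⟨fun h => h.1, fun hH => ⟨hH, fun x hx => ?_⟩⟩
  have hx' : -x ∈ c₀.1 := hx
  have := hf.pos H hH _ hx'
  simpa using this

theorem IsCoorientation.isPositiveSystem (hf : IsCoorientation c₀ f) {x₀ : V} (hx₀ : x₀ ∈ c₀.1) :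
    IsPositiveSystem f A.finite.toFinset x₀ := by
  constructor
  · intro H hH
    exact hf.pos H (A.finite.mem_toFinset.1 hH) x₀ hx₀
  · intro H hH K hK hne α h
    rw [Set.Finite.mem_toFinset] at hH hK
    have hα : α ≠ 0 := by
      rintro rfl
      have := hf.pos H hH x₀ hx₀
      simp [h] at this
    refine hne ?_
    rw [← hf.ker_eq H hH, ← hf.ker_eq K hK, h]
    ext x
    simp [hα]

variable [FiniteDimensional ℝ V] [IsTopologicalAddGroup V] [ContinuousSMul ℝ V] [T2Space V]

theorem exists_coorientation (c₀ : A.Chamber) : ∃ f, IsCoorientation c₀ f := by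
  have key : ∀ H ∈ A.hyperplanes, ∃ g : Module.Dual ℝ V,
      LinearMap.ker g = H ∧ ∀ x ∈ c₀.1, 0 < g x := by
    intro H hH
    let e : (V ⧸ H) ≃ₗ[ℝ] ℝ := LinearEquiv.ofFinrankEq _ _ (by simp [A.codim_one H hH])
    let g : V →ₗ[ℝ] ℝ := e.toLinearMap ∘ₗ H.mkQ
    have hg : LinearMap.ker g = H := by
      rw [LinearMap.ker_comp, LinearEquiv.ker, ← LinearMap.ker, Submodule.ker_mkQ]
    obtain ⟨x, hx⟩ := c₀.exists_mem
    have h0 := c₀.ne_zero hH hg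
    have hc : Continuous g := g.continuous_of_finiteDimensional
    rcases lt_or_gt_of_ne (h0 x hx) with h | h
    · refine ⟨-g, ?_, fun y hy => ?_⟩
      · ext y
        simp [← hg]
      · have := c₀.neg_of_neg hc h0 hx hy h
        simpa using this
    · refine ⟨g, hg, fun y hy => ?_⟩
      have := c₀.neg_of_neg hc.neg (by simpa using h0) hx hy (by simpa using h)
      simpa using this
  choose! f hf using key
  exact ⟨f, fun H hH => (hf H hH).1, fun H hH => (hf H hH).2⟩

namespace IsCoorientation

variable (hf : IsCoorientation c₀ f)

include hf

theorem mem_negSet_iff {c : A.Chamber} {H : Submodule ℝ V} (hH : H ∈ A.hyperplanes) {x : V}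
    (hx : x ∈ c.1) : H ∈ negSet f c ↔ f H x < 0 :=
  ⟨fun h => h.2 x hx, fun h => ⟨hH, fun _ hy =>
    c.neg_of_neg (f H).continuous_of_finiteDimensional (c.ne_zero hH (hf.ker_eq H hH)) hx hy h⟩⟩

theorem notMem_negSet_iff {c : A.Chamber} {H : Submodule ℝ V} (hH : H ∈ A.hyperplanes) {x : V}
    (hx : x ∈ c.1) : H ∉ negSet f c ↔ 0 < f H x := by
  rw [hf.mem_negSet_iff hH hx, not_lt]
  exact ⟨fun h => lt_of_le_of_ne h (c.ne_zero hH (hf.ker_eq H hH) x hx).symm, le_of_lt⟩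

theorem mem_sep₁_iff {c c' : A.Chamber} {H : Submodule ℝ V} :
    H ∈ sep₁ c c' ↔ H ∈ A.hyperplanes ∧ (H ∈ negSet f c ↔ H ∉ negSet f c') := by
  obtain ⟨x, hx⟩ := c.exists_mem
  obtain ⟨x', hx'⟩ := c'.exists_mem
  constructor
  · rintro ⟨hH, g, hg, h1, h2⟩
    refine ⟨hH, ?_⟩
    have e1 := h1 x hx
    have e2 := h2 x' hx'
    -- This positive combination of `x` and `x'` lies in `H`, so `f H` vanishes there as well and
    -- must take opposite signs at `x` and `x'`.
    have hz : g (g x' • x - g x • x') = 0 := by simp; ring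
    have hz' : f H (g x' • x - g x • x') = 0 := by
      rw [← LinearMap.mem_ker, hf.ker_eq H hH, ← hg]
      exact hz
    simp only [map_sub, map_smul, smul_eq_mul] at hz'
    rw [hf.mem_negSet_iff hH hx, hf.notMem_negSet_iff hH hx']
    constructor
    · intro h
      by_contra hcon
      nlinarith
    · intro h
      by_contra hcon
      nlinarith
  · rintro ⟨hH, h⟩
    by_cases hc : H ∈ negSet f c
    · refine ⟨hH, f H, hf.ker_eq H hH, hc.2, fun y hy => ?_⟩
      exact (hf.notMem_negSet_iff hH hy).1 (h.1 hc)
    · have hc' : H ∈ negSet f c' := not_not.1 (mt h.2 hc)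
      rw [sep₁_comm]
      refine ⟨hH, f H, hf.ker_eq H hH, hc'.2, fun y hy => ?_⟩
      exact (hf.notMem_negSet_iff hH hy).1 hc

theorem negSet_injective {c c' : A.Chamber} (h : negSet f c = negSet f c') : c = c' := by
  obtain ⟨x, hx⟩ := c.exists_mem
  obtain ⟨x', hx'⟩ := c'.exists_mem
  refine Chamber.eq_of_signs hx hx' fun H hH => ⟨f H, hf.ker_eq H hH, ?_⟩
  rw [← hf.mem_negSet_iff hH hx, h, hf.mem_negSet_iff hH hx']

theorem realizable_negSet (c : A.Chamber) : Realizable f A.finite.toFinset (negSet f c) := by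
  obtain ⟨x, hx⟩ := c.exists_mem
  refine ⟨x, fun H hH => ?_⟩
  rw [Set.Finite.mem_toFinset] at hH
  rw [hf.notMem_negSet_iff hH hx, hf.mem_negSet_iff hH hx]
  exact ⟨id, id⟩

theorem exists_chamber {S : Set (Submodule ℝ V)} (hS : S ⊆ A.hyperplanes)
    (h : Realizable f A.finite.toFinset S) : ∃ c : A.Chamber, negSet f c = S := by
  obtain ⟨x, hx⟩ := h
  simp only [Set.Finite.mem_toFinset] at hx
  have hxc : x ∈ A.complement := by
    intro H hH hxH
    rw [← hf.ker_eq H hH, LinearMap.mem_ker] at hxH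
    by_cases h : H ∈ S
    · exact ((hx H hH).1 h).ne hxH
    · exact ((hx H hH).2 h).ne' hxH
  refine ⟨⟨_, x, hxc, rfl⟩, ?_⟩
  ext H
  constructor
  · intro h
    by_contra hcon
    exact lt_asymm (h.2 x (mem_connectedComponentIn hxc)) ((hx H h.1).2 hcon)
  · intro h
    exact (hf.mem_negSet_iff (hS h) (mem_connectedComponentIn hxc)).2 ((hx H (hS h)).1 h)

end IsCoorientation

end Signs

/-! ### Minimal galleries as gallery lists. -/

section Walks

variable {V : Type u} [AddCommGroup V] [Module ℝ V] [TopologicalSpace V] {A : Arrangement V}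

/-- The hyperplane separating two adjacent chambers. -/
noncomputable def wall {c d : A.Chamber} (h : A.G₁.Adj c d) : Submodule ℝ V :=
  (Set.ncard_eq_one.1 h).choose

theorem sep₁_eq_wall {c d : A.Chamber} (h : A.G₁.Adj c d) : sep₁ c d = {wall h} :=
  (Set.ncard_eq_one.1 h).choose_spec

/-- The hyperplanes crossed by a gallery, in order. -/
noncomputable def crossings : ∀ {c d : A.Chamber}, A.G₁.Walk c d → List (Submodule ℝ V)
  | _, _, .nil => []
  | _, _, .cons h w => wall h :: crossings w

theorem length_crossings {c d : A.Chamber} (w : A.G₁.Walk c d) :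
    (crossings w).length = w.length := by
  induction w with
  | nil => rfl
  | cons h w ih => simp [crossings, ih]

theorem getElem?_crossings {c d : A.Chamber} (w : A.G₁.Walk c d) (n : ℕ) (H : Submodule ℝ V) :
    (crossings w)[n]? = some H ↔ n < w.length ∧ H ∈ sep₁ (w.getVert n) (w.getVert (n + 1)) := by
  induction w generalizing n with
  | nil => simp [crossings]
  | cons h w ih =>
    cases n with
    | zero => simp [crossings, sep₁_eq_wall h, eq_comm]
    | succ n => simp [crossings, ih]

variable [FiniteDimensional ℝ V] [IsTopologicalAddGroup V] [ContinuousSMul ℝ V] [T2Space V]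
  {c₀ : A.Chamber} {f : Submodule ℝ V → Module.Dual ℝ V}

namespace IsCoorientation

variable (hf : IsCoorientation c₀ f)

include hf

theorem mem_negSet_iff_of_adj {c d : A.Chamber} (h : A.G₁.Adj c d) (H : Submodule ℝ V) :
    H ≠ wall h → (H ∈ negSet f c ↔ H ∈ negSet f d) := by
  intro hne
  have : H ∉ sep₁ c d := by simpa [sep₁_eq_wall h] using hne
  rw [hf.mem_sep₁_iff] at this
  by_cases hH : H ∈ A.hyperplanes
  · tauto
  · exact iff_of_false (fun h => hH h.1) fun h => hH h.1

theorem negSet_of_adj {c d : A.Chamber} (h : A.G₁.Adj c d) (hw : wall h ∉ negSet f c) :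
    negSet f d = insert (wall h) (negSet f c) := by
  ext H
  by_cases hH : H = wall h
  · subst hH
    have : wall h ∈ sep₁ c d := by simp [sep₁_eq_wall h]
    rw [hf.mem_sep₁_iff] at this
    simp only [Set.mem_insert_iff, true_or, iff_true]
    tauto
  · simp [hH, hf.mem_negSet_iff_of_adj h H hH]

theorem mem_crossings {c d : A.Chamber} (w : A.G₁.Walk c d) {H : Submodule ℝ V}
    (h1 : H ∉ negSet f c) (h2 : H ∈ negSet f d) : H ∈ crossings w := by
  induction w with
  | nil => exact absurd h2 h1
  | cons h w ih =>
    by_cases hH : H = wall h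
    · simp [crossings, hH]
    · rw [hf.mem_negSet_iff_of_adj h H hH] at h1
      simp [crossings, ih h1 h2]

theorem map_negSet_support {c d : A.Chamber} (w : A.G₁.Walk c d) (hnd : (crossings w).Nodup)
    (hdis : ∀ H ∈ crossings w, H ∉ negSet f c) :
    w.support.map (negSet f) = prefixSets (negSet f c) (crossings w) := by
  induction w with
  | nil => simp [crossings, prefixSets]
  | cons h w ih =>
    rw [crossings, List.nodup_cons] at hnd
    have hw := hf.negSet_of_adj h (hdis _ (by simp [crossings]))
    simp only [SimpleGraph.Walk.support_cons, List.map_cons, crossings, prefixSets]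
    rw [ih hnd.2, hw]
    intro H hH
    rw [hw, Set.mem_insert_iff, not_or]
    exact ⟨fun h => hnd.1 (h ▸ hH), hdis H (by simp [crossings, hH])⟩

theorem exists_negSet_eq {c d : A.Chamber} (w : A.G₁.Walk c d) (hnd : (crossings w).Nodup)
    (hdis : ∀ H ∈ crossings w, H ∉ negSet f c) {p : List (Submodule ℝ V)}
    (hp : p <+: crossings w) : ∃ e : A.Chamber, negSet f e = {H | H ∈ negSet f c ∨ H ∈ p} := by
  induction w generalizing p with
  | nil =>
    have : p = [] := by simpa [crossings] using hp
    subst this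
    exact ⟨_, by simp; rfl⟩
  | @cons a b _ h w ih =>
    rw [crossings, List.nodup_cons] at hnd
    have hw := hf.negSet_of_adj h (hdis _ (by simp [crossings]))
    rcases List.IsPrefix.cases_cons hp with rfl | ⟨m, rfl, hm⟩
    · exact ⟨a, by ext; simp⟩
    · obtain ⟨e, he⟩ := ih hnd.2 (by
        intro H hH
        rw [hw, Set.mem_insert_iff, not_or]
        exact ⟨fun h => hnd.1 (h ▸ hH), hdis H (by simp [crossings, hH])⟩) hm
      refine ⟨e, ?_⟩
      rw [he, hw]
      ext H
      simp
      tauto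

theorem crossings_injective {c d : A.Chamber} (w w' : A.G₁.Walk c d)
    (h : crossings w = crossings w') : w = w' := by
  induction w with
  | nil =>
    cases w' with
    | nil => rfl
    | cons h' w' => simp [crossings] at h
  | @cons a b _ hab w ih =>
    cases w' with
    | nil => simp [crossings] at h
    | @cons _ b' _ hab' w' =>
      simp only [crossings, List.cons.injEq] at h
      have hb : b = b' := by
        refine hf.negSet_injective ?_
        ext H
        by_cases hH : H = wall hab
        · have h1 : H ∈ sep₁ a b := by simp [sep₁_eq_wall hab, hH]
          have h2 : H ∈ sep₁ a b' := by simp [sep₁_eq_wall hab', hH, h.1]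
          rw [hf.mem_sep₁_iff] at h1 h2
          tauto
        · rw [← hf.mem_negSet_iff_of_adj hab H hH, ← hf.mem_negSet_iff_of_adj hab' H (h.1 ▸ hH)]
      subst hb
      rw [ih w' h.2]

theorem exists_walk {l : List (Submodule ℝ V)} {c d : A.Chamber} (hnd : l.Nodup)
    (hdis : ∀ H ∈ l, H ∉ negSet f c) (hd : negSet f d = {H | H ∈ negSet f c ∨ H ∈ l})
    (hreal : ∀ p, p <+: l → ∃ e : A.Chamber, negSet f e = {H | H ∈ negSet f c ∨ H ∈ p}) :
    ∃ w : A.G₁.Walk c d, crossings w = l := by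
  induction l generalizing c with
  | nil =>
    have : c = d := hf.negSet_injective (by rw [hd]; ext; simp)
    subst this
    exact ⟨.nil, rfl⟩
  | cons K l ih =>
    rw [List.nodup_cons] at hnd
    obtain ⟨b, hb⟩ := hreal [K] (by simp)
    have hK : K ∉ negSet f c := hdis K (by simp)
    have hKb : K ∈ negSet f b := by simp [hb]
    have hsep : sep₁ c b = {K} := by
      ext H
      rw [hf.mem_sep₁_iff, Set.mem_singleton_iff]
      by_cases hH : H = K
      · subst hH
        simp [hK, hKb, hKb.1]
      · simp [hb, hH]
    have hadj : A.G₁.Adj c b := Set.ncard_eq_one.2 ⟨K, hsep⟩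
    have hwall : wall hadj = K := by
      have := sep₁_eq_wall hadj
      rw [hsep] at this
      exact (Set.singleton_injective this).symm
    obtain ⟨w, hw⟩ := ih (c := b) hnd.2 (by
        intro H hH
        rw [hb]
        simp only [Set.mem_ofPred_eq, List.mem_singleton, not_or]
        exact ⟨hdis H (by simp [hH]), fun h => hnd.1 (h ▸ hH)⟩) (by
        rw [hd, hb]
        ext H
        simp
        tauto) (by
        intro p hp
        obtain ⟨e, he⟩ := hreal (K :: p) (List.cons_prefix_cons.2 ⟨rfl, hp⟩)
        refine ⟨e, ?_⟩
        rw [he, hb]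
        ext H
        simp
        tauto)
    exact ⟨.cons hadj w, by rw [crossings, hwall, hw]⟩

/-- Gallery lists are the crossing sequences of walks from `c₀` to `-c₀`. -/
theorem exists_walk_of_galleryList {l : List (Submodule ℝ V)}
    (hl : IsGalleryList f A.finite.toFinset l) : ∃ w : A.G₁.Walk c₀ (-c₀), crossings w = l := by
  refine hf.exists_walk hl.nodup (by simp [hf.negSet_base]) ?_ ?_
  · rw [hf.negSet_base, hf.negSet_neg_base]
    ext H
    simp [hl.mem_iff]
  · intro p hp
    obtain ⟨e, he⟩ := hf.exists_chamber (S := {H | H ∈ p}) (fun H hH => by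
      have := hp.subset hH
      rwa [hl.mem_iff, Set.Finite.mem_toFinset] at this) (hl.realizable p hp)
    exact ⟨e, by rw [he, hf.negSet_base]; simp⟩

theorem card_le_length (w : A.G₁.Walk c₀ (-c₀)) : A.finite.toFinset.card ≤ w.length := by
  classical
  rw [← length_crossings]
  refine le_trans (Finset.card_le_card fun H hH => ?_) (crossings w).toFinset_card_le
  rw [List.mem_toFinset]
  rw [Set.Finite.mem_toFinset] at hH
  exact hf.mem_crossings w (by simp [hf.negSet_base]) (by rwa [hf.negSet_neg_base])

/-- Every hyperplane separates `c₀` from `-c₀`, so it must be crossed; the length leaves room for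
only one crossing of each. -/
theorem isGalleryList_crossings (w : A.G₁.Walk c₀ (-c₀))
    (hw : w.length = A.finite.toFinset.card) :
    IsGalleryList f A.finite.toFinset (crossings w) := by
  classical
  have hsub : A.finite.toFinset ⊆ (crossings w).toFinset := by
    intro H hH
    rw [List.mem_toFinset]
    rw [Set.Finite.mem_toFinset] at hH
    exact hf.mem_crossings w (by simp [hf.negSet_base]) (by rwa [hf.negSet_neg_base])
  have hcard : (crossings w).toFinset.card ≤ A.finite.toFinset.card := by
    rw [← hw, ← length_crossings]
    exact (crossings w).toFinset_card_le
  have heq := Finset.eq_of_subset_of_card_le hsub hcard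
  have hnd : (crossings w).Nodup := by
    rw [← Multiset.coe_nodup, ← Multiset.toFinset_card_eq_card_iff_nodup]
    change (crossings w).toFinset.card = (crossings w).length
    rw [← heq, length_crossings, hw]
  refine ⟨hnd, fun H => by rw [heq, List.mem_toFinset], fun p hp => ?_⟩
  obtain ⟨e, he⟩ := hf.exists_negSet_eq w hnd (by simp [hf.negSet_base]) hp
  have := hf.realizable_negSet e
  rw [he] at this
  refine this.congr fun H _ => ?_
  simp [hf.negSet_base]

end IsCoorientation

end Walks

end Arrangement

namespace Arrangement

/-! ### Induced galleries in localizations. -/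

section Quotients

variable {V : Type u} [AddCommGroup V] [Module ℝ V] [TopologicalSpace V] {A : Arrangement V}

/-- The hyperplanes of `A` through `X` on whose negative side the preimage of a chamber of the
localization lies. -/
def negSetQuot (f : Submodule ℝ V → Module.Dual ℝ V) {X : Submodule ℝ V}
    (D : (A.localization X).Chamber) : Set (Submodule ℝ V) :=
  {H ∈ A.above X | ∀ x, X.mkQ x ∈ D.1 → f H x < 0}

variable [FiniteDimensional ℝ V] [IsTopologicalAddGroup V] [ContinuousSMul ℝ V] [T2Space V]
  {c₀ : A.Chamber} {f : Submodule ℝ V → Module.Dual ℝ V}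

namespace IsCoorientation

variable (hf : IsCoorientation c₀ f)

include hf

theorem mem_negSetQuot_iff {X H : Submodule ℝ V} {D : (A.localization X).Chamber}
    (hH : H ∈ A.above X) {x : V} (hx : X.mkQ x ∈ D.1) : H ∈ negSetQuot f D ↔ f H x < 0 := by
  have hle : X ≤ LinearMap.ker (f H) := by rw [hf.ker_eq H hH.1]; exact hH.2
  refine ⟨fun h => h.2 x hx, fun h => ⟨hH, fun y hy => ?_⟩⟩
  let g : (V ⧸ X) →ₗ[ℝ] ℝ := X.liftQ (f H) hle
  have hg : LinearMap.ker g = H.map X.mkQ := by rw [Submodule.ker_liftQ, hf.ker_eq H hH.1]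
  have hcont : Continuous g :=
    continuous_quot_lift _ (f H).continuous_of_finiteDimensional
  exact D.neg_of_neg hcont (D.ne_zero ⟨H, hH, rfl⟩ hg) hx hy h

theorem negSetQuot_injective (X : Submodule ℝ V) :
    Function.Injective (negSetQuot f : (A.localization X).Chamber → Set (Submodule ℝ V)) := by
  intro D D' h
  obtain ⟨y, hy⟩ := D.exists_mem
  obtain ⟨y', hy'⟩ := D'.exists_mem
  obtain ⟨x, rfl⟩ := X.mkQ_surjective y
  obtain ⟨x', rfl⟩ := X.mkQ_surjective y'
  refine Chamber.eq_of_signs hy hy' ?_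
  rintro _ ⟨H, hH, rfl⟩
  have hle : X ≤ LinearMap.ker (f H) := by rw [hf.ker_eq H hH.1]; exact hH.2
  refine ⟨X.liftQ (f H) hle, by rw [Submodule.ker_liftQ, hf.ker_eq H hH.1], ?_⟩
  simp only [Submodule.mkQ_apply, Submodule.liftQ_apply]
  rw [← hf.mem_negSetQuot_iff hH hy, h, hf.mem_negSetQuot_iff hH hy']

theorem negSetQuot_quot (c : A.Chamber) (X : Submodule ℝ V) :
    negSetQuot f (c.quot X) = negSet f c ∩ A.above X := by
  obtain ⟨x, hx⟩ := c.exists_mem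
  ext H
  constructor
  · intro h
    have := (hf.mem_negSetQuot_iff h.1 (c.mkQ_mem_quot X hx)).1 h
    exact ⟨(hf.mem_negSet_iff h.1.1 hx).2 this, h.1⟩
  · rintro ⟨h, hH⟩
    exact (hf.mem_negSetQuot_iff hH (c.mkQ_mem_quot X hx)).2 (h.2 x hx)

-- The negative set of `c / X` is the trace of that of `c` on `A.above X`, so removing repetitions
-- leaves exactly the crossings of hyperplanes through `X`.
open Classical in
theorem map_quot_gallery (r : MinimalGallery c₀ (-c₀)) (hnd : (crossings r.1).Nodup)
    (X : Submodule ℝ V) : (r.quot X).map (negSetQuot f) =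
      prefixSets ∅ ((crossings r.1).filter (· ∈ A.above X)) := by
  refine (List.map_destutter (f := negSetQuot f) (R₂ := fun s t => s ≠ t)
    fun a _ b _ => (hf.negSetQuot_injective X).ne_iff.symm).trans ?_
  rw [List.map_map]
  have : (negSetQuot f ∘ fun b : A.Chamber => b.quot X) = (· ∩ A.above X) ∘ negSet f := by
    ext1 c
    exact hf.negSetQuot_quot c X
  rw [this, ← List.map_map, hf.map_negSet_support r.1 hnd (by simp [hf.negSet_base]),
    destutter_map_prefixSets _ hnd (by simp [hf.negSet_base]), hf.negSet_base, Set.empty_inter]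

open Classical in
/-- Two galleries induce the same gallery of `A_X` iff they cross the hyperplanes through `X` in the
same order. -/
theorem quot_eq_quot_iff (r r' : MinimalGallery c₀ (-c₀))
    (hr : IsGalleryList f A.finite.toFinset (crossings r.1))
    (hr' : IsGalleryList f A.finite.toFinset (crossings r'.1)) (X : Submodule ℝ V) :
    r.quot X = r'.quot X ↔ ∀ a ∈ A.above X, ∀ b ∈ A.above X,
      (crossings r.1).Before a b → (crossings r'.1).Before a b := by
  have h1 := hf.map_quot_gallery r hr.nodup X
  have h2 := hf.map_quot_gallery r' hr'.nodup X
  have hmem : ∀ H, H ∈ crossings r.1 ↔ H ∈ crossings r'.1 := fun H => by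
    rw [hr.mem_iff, hr'.mem_iff]
  have hfil := List.filter_eq_filter_iff_before hr.nodup hr'.nodup hmem (· ∈ A.above X)
  have hstep : r.quot X = r'.quot X ↔ (crossings r.1).filter (· ∈ A.above X) =
      (crossings r'.1).filter (· ∈ A.above X) := by
    constructor
    · intro h
      rw [h, h2] at h1
      exact (prefixSets_inj (hr'.nodup.filter _) (hr.nodup.filter _) (by simp) (by simp) h1).symm
    · intro h
      rw [h, ← h2] at h1
      exact List.map_injective_iff.2 (hf.negSetQuot_injective X) h1
  rw [hstep, hfil]
  simp only [hr.mem_iff, Set.Finite.mem_toFinset, decide_eq_true_eq]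
  exact ⟨fun h a ha b hb => h a ha.1 b hb.1 ha hb, fun h a _ b _ ha hb => h a ha b hb⟩

end IsCoorientation

end Quotients

/-! ### Flats of codimension two. -/

section Planes

variable {V : Type u} [AddCommGroup V] [Module ℝ V] {A : Arrangement V}

theorem exists_eq_smul_add_smul {g h k : Module.Dual ℝ V}
    (hle : LinearMap.ker g ⊓ LinearMap.ker h ≤ LinearMap.ker k) :
    ∃ α β : ℝ, k = α • g + β • h := by
  have := mem_span_of_iInf_ker_le_ker (L := ![g, h]) (K := k) (by
    refine le_trans ?_ hle
    exact le_inf (iInf_le _ 0) (iInf_le _ 1))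
  rw [Matrix.range_cons, Matrix.range_cons, Matrix.range_empty, Set.union_empty,
    Set.singleton_union, Submodule.mem_span_pair] at this
  obtain ⟨α, β, e⟩ := this
  exact ⟨α, β, e.symm⟩

theorem ker_inf_ker_le {g h k : Module.Dual ℝ V} (hk : ∃ α β : ℝ, k = α • g + β • h) :
    LinearMap.ker g ⊓ LinearMap.ker h ≤ LinearMap.ker k := by
  obtain ⟨α, β, rfl⟩ := hk
  rintro x ⟨h1, h2⟩
  have h1 : g x = 0 := h1
  have h2 : h x = 0 := h2
  simp [h1, h2]

variable [FiniteDimensional ℝ V]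

theorem inf_mem_latticeRank_two {H K : Submodule ℝ V} (hH : H ∈ A.hyperplanes)
    (hK : K ∈ A.hyperplanes) (hne : H ≠ K) : H ⊓ K ∈ A.latticeRank 2 := by
  refine ⟨⟨{H, K}, ?_, by simp⟩, ?_⟩
  · rintro _ (rfl | rfl) <;> assumption
  have h1 := A.codim_one H hH
  have h2 := A.codim_one K hK
  have e1 := H.finrank_quotient_add_finrank
  have e2 := K.finrank_quotient_add_finrank
  have e3 := (H ⊓ K).finrank_quotient_add_finrank
  have e4 := Submodule.finrank_sup_add_finrank_inf_eq H K
  have e5 : Module.finrank ℝ ↥(H ⊔ K) ≤ Module.finrank ℝ V := Submodule.finrank_le _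
  have e6 : Module.finrank ℝ H < Module.finrank ℝ ↥(H ⊔ K) := by
    refine Submodule.finrank_lt_finrank_of_lt (lt_of_le_of_ne le_sup_left fun h => hne ?_)
    have hle : K ≤ H := by rw [h]; exact le_sup_right
    exact (Submodule.eq_of_le_of_finrank_eq hle (by omega)).symm
  omega

theorem eq_of_le_of_mem_latticeRank {X Y : Submodule ℝ V} {n : ℕ} (hX : X ∈ A.latticeRank n)
    (hY : Y ∈ A.latticeRank n) (h : X ≤ Y) : X = Y := by
  refine Submodule.eq_of_le_of_finrank_eq h ?_
  have e1 := X.finrank_quotient_add_finrank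
  have e2 := Y.finrank_quotient_add_finrank
  have h1 := hX.2
  have h2 := hY.2
  omega

end Planes

/-! ### From modular flags to modular steps. -/

section Flags

variable {V : Type u} [AddCommGroup V] [Module ℝ V] {A : Arrangement V}

theorem Flag.IsModular.exists_hyperplane {F : A.Flag} (hF : F.IsModular)
    (i : Fin (Module.finrank ℝ V)) {H H' : Submodule ℝ V} (hH : H ∈ A.above (F.space i.castSucc))
    (hH' : H' ∈ A.above (F.space i.castSucc)) (hne : H ≠ H') (h1 : ¬ F.space i.succ ≤ H)
    (h2 : ¬ F.space i.succ ≤ H') : ∃ K ∈ A.above (F.space i.succ), H ⊓ H' ≤ K := by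
  set X := F.space i.castSucc with hX
  have hcomap : ∀ {K : Submodule ℝ V}, X ≤ K → (K.map X.mkQ).comap X.mkQ = K := by
    intro K hK
    rw [Submodule.comap_map_mkQ, sup_eq_right.2 hK]
  have hle : ∀ {Y K : Submodule ℝ V}, X ≤ K → Y.map X.mkQ ≤ K.map X.mkQ → Y ≤ K := by
    intro Y K hK h
    rw [Submodule.map_le_iff_le_comap, hcomap hK] at h
    exact h
  obtain ⟨_, ⟨K, hK, rfl⟩, h3, h4⟩ := (hF i).2.2 _ ⟨H, hH, rfl⟩ _ ⟨H', hH', rfl⟩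
    (fun h => hne (by rw [← hcomap hH.2, ← hcomap hH'.2]; exact congrArg _ h))
    (fun h => h1 (hle hH.2 h)) (fun h => h2 (hle hH'.2 h))
  refine ⟨K, ⟨hK.1, hle hK.2 h3⟩, hle hK.2 (le_trans ?_ h4)⟩
  exact Submodule.map_inf_le _

/-- The hyperplanes containing the `m`-th member of a flag (its last member if `m` is too large). -/
noncomputable def Flag.tower (F : A.Flag) (m : ℕ) : Finset (Submodule ℝ V) :=
  (A.finite.subset fun _ h => h.1 :
    (A.above (F.space ⟨min m (Module.finrank ℝ V), by omega⟩)).Finite).toFinset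

theorem Flag.mem_tower {F : A.Flag} {m : ℕ} (hm : m ≤ Module.finrank ℝ V) {H : Submodule ℝ V} :
    H ∈ F.tower m ↔ H ∈ A.above (F.space ⟨m, by omega⟩) := by
  simp [Flag.tower, min_eq_left hm]

theorem Flag.tower_zero [FiniteDimensional ℝ V] (F : A.Flag) : F.tower 0 = A.finite.toFinset := by
  ext H
  rw [Flag.mem_tower (Nat.zero_le _), Set.Finite.mem_toFinset]
  have : F.space ⟨0, by omega⟩ = ⊥ := Submodule.finrank_eq_zero.1 (F.finrank_eq _)
  rw [this]
  exact ⟨fun h => h.1, fun h => ⟨h, bot_le⟩⟩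

theorem Flag.tower_of_le [FiniteDimensional ℝ V] (F : A.Flag) {m : ℕ} (hm : Module.finrank ℝ V ≤ m) : F.tower m = ∅ := by
  rw [Finset.eq_empty_iff_forall_notMem]
  intro H hH
  simp only [Flag.tower, Set.Finite.mem_toFinset, min_eq_right hm] at hH
  have : F.space ⟨Module.finrank ℝ V, by omega⟩ = ⊤ :=
    Submodule.eq_top_of_finrank_eq (F.finrank_eq _)
  have hle := hH.2
  rw [this, top_le_iff] at hle
  have h1 := A.codim_one H hH.1
  have h2 := H.finrank_quotient_add_finrank
  rw [hle, finrank_top] at h2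
  rw [hle] at h1
  omega

variable [TopologicalSpace V]

/-- Membership of `K` is a separate condition because `Before` does not require the later entry to
occur. -/
theorem crossesBefore_iff {c d : A.Chamber} {r : MinimalGallery c d} [DecidableEq (Submodule ℝ V)]
    (hnd : (crossings r.1).Nodup) {H K : Submodule ℝ V} :
    r.CrossesBefore H K ↔ (crossings r.1).Before H K ∧ K ∈ crossings r.1 := by
  unfold MinimalGallery.CrossesBefore MinimalGallery.CrossesAt
  simp only [← getElem?_crossings]
  have key : ∀ n L, (crossings r.1)[n]? = some L →
      L ∈ crossings r.1 ∧ (crossings r.1).idxOf L = n := by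
    intro n L h
    obtain ⟨hn, rfl⟩ := List.getElem?_eq_some_iff.1 h
    exact ⟨List.getElem_mem _, hnd.idxOf_getElem _ _⟩
  have key' : ∀ L ∈ crossings r.1, (crossings r.1)[(crossings r.1).idxOf L]? = some L :=
    fun L hL => List.getElem?_idxOf hL
  constructor
  · rintro ⟨m, n, hmn, hm, hn⟩
    refine ⟨?_, (key n K hn).1⟩
    unfold List.Before
    rwa [(key m H hm).2, (key n K hn).2]
  · rintro ⟨h, hK⟩
    have hH : H ∈ crossings r.1 := by
      refine List.idxOf_lt_length_iff.1 (lt_trans h (List.idxOf_lt_length_iff.2 hK))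
    exact ⟨_, _, h, key' H hH, key' K hK⟩

variable [FiniteDimensional ℝ V]

/-- By incidence the cone spans `X`, so it cannot lie in `Y`. -/
theorem Chamber.IsIncident.exists_mem_notMem {c : A.Chamber} {X Y : Submodule ℝ V}
    (h : c.IsIncident X) (hYX : ¬ X ≤ Y) : ∃ v ∈ closure c.1, v ∈ X ∧ v ∉ Y := by
  by_contra! hcon
  have hspan : Submodule.span ℝ (closure c.1 ∩ (X : Set V)) = X :=
    Submodule.eq_of_le_of_finrank_eq (Submodule.span_le.2 Set.inter_subset_right) h
  refine hYX ?_
  rw [← hspan, Submodule.span_le]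
  exact fun v hv => hcon v hv.1 hv.2

theorem isIncidentFlag_iff {c d : A.Chamber} {f : Submodule ℝ V → Module.Dual ℝ V}
    {r : MinimalGallery c d} [DecidableEq (Submodule ℝ V)]
    (hr : IsGalleryList f A.finite.toFinset (crossings r.1)) (F : A.Flag) :
    r.IsIncidentFlag F ↔ IsTowerIncident F.tower 0 (crossings r.1) := by
  have hK : ∀ K ∈ A.hyperplanes, K ∈ crossings r.1 := fun K hK => by
    rwa [hr.mem_iff, Set.Finite.mem_toFinset]
  constructor
  · intro h m _ a ha b hb hb'
    by_cases hm : Module.finrank ℝ V ≤ m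
    · simp [F.tower_of_le hm] at hb
    rw [not_le] at hm
    rw [Flag.mem_tower hm] at ha hb'
    rw [Flag.mem_tower hm.le] at hb
    exact ((crossesBefore_iff hr.nodup).1
      (h ⟨m, by omega⟩ ⟨m + 1, by omega⟩ (by simp) a ha b ⟨hb, hb'⟩)).1
  · intro h i j hij a ha b hb
    rw [crossesBefore_iff hr.nodup]
    refine ⟨?_, hK b hb.1.1⟩
    have hi : b ∈ F.tower i := (Flag.mem_tower (by omega)).2 hb.1
    have hj : b ∉ F.tower j := fun h => hb.2 ((Flag.mem_tower (by omega)).1 h)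
    -- Locating the level of `b` between `i` and `j` reduces incidence for arbitrary `i < j` to
    -- consecutive stages.
    have hex : ∃ m, (i : ℕ) ≤ m ∧ m < j ∧ b ∈ F.tower m ∧ b ∉ F.tower (m + 1) := by
      by_contra! hcon
      have : ∀ n, (i : ℕ) + n ≤ j → b ∈ F.tower (i + n) := by
        intro n
        induction n with
        | zero => exact fun _ => hi
        | succ n ih => exact fun hn => hcon (i + n) (by omega) (by omega) (ih (by omega))
      have hlt : (i : ℕ) < j := hij
      have h2 := this (j - i) (by omega)
      rw [Nat.add_sub_cancel' hlt.le] at h2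
      exact hj h2
    obtain ⟨m, _, hmj, hbm, hbm'⟩ := hex
    refine h m (Nat.zero_le _) a ?_ b hbm hbm'
    rw [Flag.mem_tower (by omega)]
    refine ⟨ha.1, le_trans (F.strictMono.monotone ?_) ha.2⟩
    exact Fin.mk_le_of_le_val hmj

variable [IsTopologicalAddGroup V] [ContinuousSMul ℝ V] [T2Space V] {c₀ : A.Chamber}
  {f : Submodule ℝ V → Module.Dual ℝ V}

theorem IsCoorientation.nonneg_of_mem_closure (hf : IsCoorientation c₀ f) {H : Submodule ℝ V}
    (hH : H ∈ A.hyperplanes) {v : V} (hv : v ∈ closure c₀.1) : 0 ≤ f H v := by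
  have hcl : IsClosed {x | 0 ≤ f H x} :=
    isClosed_le continuous_const (f H).continuous_of_finiteDimensional
  exact closure_minimal (fun x hx => (hf.pos H hH x hx).le) hcl hv

/-- The vector is a point of the closed chamber in the next flag member but not in the current one.
All functionals are nonnegative there, and by a dimension count one of stage `m` vanishes only if
its hyperplane contains the next member. -/
theorem Flag.exists_modularStep {F : A.Flag} (hF : F.IsModular) (hf : IsCoorientation c₀ f)
    (hc₀ : c₀.IsIncidentFlag F) (m : ℕ) :
    ∃ v, IsModularStep f (F.tower (m + 1)) (F.tower m) v := by
  by_cases hm : Module.finrank ℝ V ≤ m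
  -- Stages from `dim V` on are empty, so any vector serves.
  · refine ⟨0, ?_, ?_, ?_, ?_⟩ <;> simp [F.tower_of_le hm, F.tower_of_le (hm.trans (Nat.le_succ m))]
  rw [not_le] at hm
  let i : Fin (Module.finrank ℝ V) := ⟨m, hm⟩
  have mem : ∀ {H}, H ∈ F.tower m ↔ H ∈ A.above (F.space i.castSucc) := fun {H} =>
    Flag.mem_tower hm.le
  have mem' : ∀ {H}, H ∈ F.tower (m + 1) ↔ H ∈ A.above (F.space i.succ) := fun {H} =>
    Flag.mem_tower hm
  have hlt : F.space i.castSucc < F.space i.succ := F.strictMono Fin.castSucc_lt_succ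
  obtain ⟨v, hvc, hv, hv'⟩ := (hc₀ i.succ).exists_mem_notMem hlt.not_ge
  have hsup : ∀ K : Submodule ℝ V, F.space i.castSucc ≤ K → v ∈ K → F.space i.succ ≤ K := by
    intro K hK hvK
    have hlt' : F.space i.castSucc < F.space i.succ ⊓ K :=
      lt_of_le_of_ne (le_inf hlt.le hK) fun h => hv' (by rw [h]; exact ⟨hv, hvK⟩)
    have h1 := Submodule.finrank_lt_finrank_of_lt hlt'
    rw [F.finrank_eq] at h1
    have h2 := F.finrank_eq i.succ
    have h3 : F.space i.succ ⊓ K = F.space i.succ := by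
      refine Submodule.eq_of_le_of_finrank_le inf_le_left ?_
      rw [h2]
      simpa using h1
    exact inf_eq_left.1 h3
  have hpos : ∀ H ∈ F.tower m, H ∉ F.tower (m + 1) → 0 < f H v := by
    intro H hH hH'
    rw [mem] at hH
    refine lt_of_le_of_ne (hf.nonneg_of_mem_closure hH.1 hvc) fun h0 => hH' ?_
    rw [mem']
    refine ⟨hH.1, hsup H hH.2 ?_⟩
    rw [← hf.ker_eq H hH.1]
    exact h0.symm
  have hzero : ∀ K ∈ F.tower (m + 1), f K v = 0 := by
    intro K hK
    rw [mem'] at hK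
    have : v ∈ LinearMap.ker (f K) := by
      rw [hf.ker_eq K hK.1]
      exact hK.2 hv
    exact this
  refine ⟨v, fun H hH => ?_, hzero, hpos, ?_⟩
  · rw [mem'] at hH
    rw [mem]
    exact ⟨hH.1, hlt.le.trans hH.2⟩
  · intro H hH hH' K hK hK' hne
    have pH := hpos H hH hH'
    have pK := hpos K hK hK'
    rw [mem] at hH hK
    rw [mem'] at hH' hK'
    obtain ⟨L, hL, hle⟩ := hF.exists_hyperplane i hH hK hne (fun h => hH' ⟨hH.1, h⟩)
      fun h => hK' ⟨hK.1, h⟩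
    refine ⟨L, mem'.2 hL, ?_⟩
    rw [← hf.ker_eq H hH.1, ← hf.ker_eq K hK.1, ← hf.ker_eq L hL.1] at hle
    obtain ⟨α, β, e⟩ := exists_eq_smul_add_smul hle
    have ev : 0 = α * f H v + β * f K v := by
      rw [← hzero L (mem'.2 hL), e]
      simp
    have hα : α ≠ 0 := by
      rintro rfl
      have hβ : β = 0 := by
        simpa [pK.ne'] using ev.symm
      obtain ⟨x, hx⟩ := c₀.exists_mem
      have := hf.pos L hL.1 x hx
      simp [e, hβ] at this
    -- Since `f L` vanishes at `v`, the pair `(α, β)` is proportional to `(f K v, -f H v)`; this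
    -- ratio is the constant.
    refine ⟨f K v / α, div_ne_zero pK.ne' hα, ?_⟩
    have hHv : f H v = -(β / α) * f K v := by
      field_simp
      linarith
    rw [hHv, e, smul_add, smul_smul, smul_smul, div_mul_cancel₀ _ hα]
    module

end Flags

/-! ### Distances in `G₂`. -/

section Accessibility

variable {V : Type u} [AddCommGroup V] [Module ℝ V] [TopologicalSpace V] {A : Arrangement V}
  {c c' : A.Chamber}

theorem sep₂_subset_union (r s t : MinimalGallery c c') : sep₂ r t ⊆ sep₂ r s ∪ sep₂ s t := by
  rintro X ⟨hX, h⟩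
  by_cases h1 : r.quot X = s.quot X
  · exact Or.inr ⟨hX, fun h2 => h (h1.trans h2)⟩
  · exact Or.inl ⟨hX, h1⟩

theorem encard_sep₂_le_length {r s : MinimalGallery c c'} (w : (G₂ c c').Walk r s) :
    (sep₂ r s).encard ≤ w.length := by
  induction w with
  | nil => simp [sep₂]
  | @cons a b d h w ih =>
    have h1 : (sep₂ a b).encard = 1 := by
      obtain ⟨X, hX⟩ := Set.ncard_eq_one.1 h
      simp [hX]
    calc (sep₂ a d).encard ≤ (sep₂ a b ∪ sep₂ b d).encard :=
          Set.encard_le_encard (sep₂_subset_union a b d)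
      _ ≤ (sep₂ a b).encard + (sep₂ b d).encard := Set.encard_union_le _ _
      _ ≤ 1 + w.length := by rw [h1]; gcongr
      _ = _ := by simp [add_comm]

theorem finite_sep₂ (r s : MinimalGallery c c') : (sep₂ r s).Finite := by
  have : A.lattice.Finite := by
    refine (A.finite.powerset.image sInf).subset ?_
    rintro X ⟨S, hS, rfl⟩
    exact ⟨S, hS, rfl⟩
  exact this.subset fun X hX => hX.1.1

/-- A gallery from which every other gallery can be approached one codimension two flat at a time
is accessible. -/
theorem isAccessible_of_exists_flip {r₀ : MinimalGallery c c'}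
    (h : ∀ r, r ≠ r₀ → ∃ r' X, sep₂ r r' = {X} ∧ X ∈ sep₂ r₀ r ∧ X ∉ sep₂ r₀ r') :
    (G₂ c c').IsAccessible sep₂ r₀ := by
  have hle : ∀ n r, (sep₂ r₀ r).encard = (n : ℕ) → (G₂ c c').edist r₀ r ≤ n := by
    intro n
    induction n with
    | zero =>
      intro r hr
      by_cases hne : r = r₀
      · simp [hne]
      · obtain ⟨r', X, -, h2, -⟩ := h r hne
        simp only [Nat.cast_zero, Set.encard_eq_zero] at hr
        simp [hr] at h2
    | succ n ih =>
      intro r hr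
      by_cases hne : r = r₀
      · simp [hne]
      obtain ⟨r', X, h1, h2, h3⟩ := h r hne
      -- Away from `X` the galleries `r` and `r'` induce the same galleries, so the move deletes
      -- exactly `X` from the difference with `r₀`.
      have heq : sep₂ r₀ r' = sep₂ r₀ r \ {X} := by
        ext Y
        constructor
        · intro hY
          have hYX : Y ≠ X := fun h => h3 (h ▸ hY)
          refine ⟨⟨hY.1, fun h' => hYX ?_⟩, hYX⟩
          have : Y ∈ sep₂ r r' := ⟨hY.1, fun h4 => hY.2 (h'.trans h4)⟩
          rwa [h1] at this
        · rintro ⟨hY, hYX⟩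
          refine ⟨hY.1, fun h' => hYX ?_⟩
          have : Y ∈ sep₂ r r' := ⟨hY.1, fun h4 => hY.2 (h'.trans h4.symm)⟩
          rwa [h1] at this
      have hcard : (sep₂ r₀ r').encard = (n : ℕ) := by
        have := Set.encard_sdiff_singleton_add_one h2
        rw [← heq, hr] at this
        push_cast at this
        exact (ENat.addLECancellable_of_ne_top ENat.one_ne_top).inj_left.1 this
      have hadj : (G₂ c c').Adj r' r := by
        rw [SimpleGraph.adj_comm]
        exact Set.ncard_eq_one.2 ⟨X, h1⟩
      calc (G₂ c c').edist r₀ r ≤ (G₂ c c').edist r₀ r' + (G₂ c c').edist r' r :=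
            SimpleGraph.edist_triangle
        _ ≤ n + 1 := by
          gcongr
          · exact ih r' hcard
          · exact (SimpleGraph.edist_eq_one_iff_adj.2 hadj).le
        _ = _ := by push_cast; rfl
  intro r
  refine le_antisymm ?_ ?_
  · rw [(finite_sep₂ r₀ r).encard_eq_coe_toFinset_card]
    exact hle _ r (finite_sep₂ r₀ r).encard_eq_coe_toFinset_card
  · exact le_iInf fun w => encard_sep₂_le_length w

end Accessibility

end Arrangement

/-! ### The main theorem. -/

open Arrangement in
theorem mainTheorem2 {V : Type*} [AddCommGroup V] [Module ℝ V] [FiniteDimensional ℝ V]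
    [TopologicalSpace V] [IsTopologicalAddGroup V] [ContinuousSMul ℝ V] [T2Space V]
    (A : Arrangement V) (hess : A.IsEssential) (hss : A.IsSupersolvable)
    (F : A.Flag) (hF : F.IsModular) (c₀ : A.Chamber) (hc₀ : c₀.IsIncidentFlag F) :
    (∃! r₀ : Arrangement.MinimalGallery c₀ (-c₀), r₀.IsIncidentFlag F) ∧
      ∀ r₀ : Arrangement.MinimalGallery c₀ (-c₀), r₀.IsIncidentFlag F →
        (Arrangement.G₂ c₀ (-c₀)).IsAccessible Arrangement.sep₂ r₀ := by
  classical
  obtain ⟨f, hf⟩ := exists_coorientation c₀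
  obtain ⟨x₀, hx₀⟩ := c₀.exists_mem
  have hpos := hf.isPositiveSystem hx₀
  choose vs hstep using Flag.exists_modularStep hF hf hc₀
  have hend : F.tower (0 + Module.finrank ℝ V) = ∅ := F.tower_of_le (by simp)
  have hend' : F.tower (Module.finrank ℝ V) = ∅ := F.tower_of_le le_rfl
  obtain ⟨l₀, hl₀, hinc₀⟩ := exists_incident_gallery hstep (x₀ := x₀) _ 0 hend
    (by rw [F.tower_zero]; exact hpos.pos)
  rw [F.tower_zero] at hl₀
  have hlen : ∀ w : A.G₁.Walk c₀ (-c₀), IsGalleryList f A.finite.toFinset (crossings w) →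
      w.length = A.finite.toFinset.card := by
    intro w hw
    rw [← length_crossings, ← List.toFinset_card_of_nodup hw.nodup]
    congr 1
    ext H
    rw [List.mem_toFinset, hw.mem_iff]
  obtain ⟨w₀, hw₀⟩ := hf.exists_walk_of_galleryList hl₀
  -- The incident gallery shows that `-c₀` is reachable with one crossing per hyperplane; minimality
  -- then forces every minimal gallery to be a gallery list.
  have hdist : A.G₁.dist c₀ (-c₀) = A.finite.toFinset.card := by
    refine le_antisymm ?_ ?_
    · rw [← hlen w₀ (hw₀ ▸ hl₀)]
      exact SimpleGraph.dist_le w₀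
    · obtain ⟨w, hw⟩ := w₀.reachable.exists_walk_length_eq_dist
      rw [← hw]
      exact hf.card_le_length w
  have hgal : ∀ r : MinimalGallery c₀ (-c₀), IsGalleryList f A.finite.toFinset (crossings r.1) :=
    fun r => hf.isGalleryList_crossings r.1 (r.2.trans hdist)
  have hex : ∀ l, IsGalleryList f A.finite.toFinset l →
      ∃ r : MinimalGallery c₀ (-c₀), crossings r.1 = l := by
    intro l hl
    obtain ⟨w, hw⟩ := hf.exists_walk_of_galleryList hl
    exact ⟨⟨w, (hlen w (hw ▸ hl)).trans hdist.symm⟩, hw⟩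
  have huniq : ∀ r r' : MinimalGallery c₀ (-c₀), r.IsIncidentFlag F → r'.IsIncidentFlag F →
      r = r' := by
    intro r r' hr hr'
    rw [isIncidentFlag_iff (hgal r)] at hr
    rw [isIncidentFlag_iff (hgal r')] at hr'
    refine Subtype.ext (hf.crossings_injective _ _ ?_)
    exact IsTowerIncident.eq hstep (by rwa [F.tower_zero]) hend'
      (by rw [F.tower_zero]; exact hgal r) (by rw [F.tower_zero]; exact hgal r') hr hr'
  constructor
  · obtain ⟨r₀, hr₀⟩ := hex l₀ hl₀
    have hinc : r₀.IsIncidentFlag F := (isIncidentFlag_iff (hgal r₀) F).2 (hr₀ ▸ hinc₀)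
    exact ⟨r₀, hinc, fun r hr => huniq r r₀ hr hinc⟩
  intro r₀ hr₀
  refine isAccessible_of_exists_flip fun r hne => ?_
  have hnot : ¬ IsTowerIncident F.tower 0 (crossings r.1) := fun h =>
    hne (huniq r r₀ ((isIncidentFlag_iff (hgal r) F).2 h) hr₀)
  obtain ⟨l', g, k, hl', ⟨j, -, hk, hg, hg'⟩, hb, hb', hagree⟩ := exists_tower_flip hstep _ 0 hend _
    (by rw [F.tower_zero]; exact hgal r) hnot
  rw [F.tower_zero] at hl'
  obtain ⟨r', rfl⟩ := hex l' hl'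
  have hb₀ := (isIncidentFlag_iff (hgal r₀) F).1 hr₀ j (Nat.zero_le _) k hk g hg hg'
  have hanti : Antitone F.tower := antitone_nat_of_succ_le fun m => (hstep m).subset
  have hkB : k ∈ A.finite.toFinset := F.tower_zero ▸ hanti (Nat.zero_le _) hk
  have hgB : g ∈ A.finite.toFinset := F.tower_zero ▸ hanti (Nat.zero_le _) hg
  have hkA := A.finite.mem_toFinset.1 hkB
  have hgA := A.finite.mem_toFinset.1 hgB
  have hkg : k ≠ g := fun h => hg' (h ▸ hk)
  have hX := inf_mem_latticeRank_two hkA hgA hkg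
  have hkX : k ∈ A.above (k ⊓ g) := ⟨hkA, inf_le_left⟩
  have hgX : g ∈ A.above (k ⊓ g) := ⟨hgA, inf_le_right⟩
  refine ⟨r', k ⊓ g, ?_, ⟨hX, ?_⟩, ?_⟩
  · ext Y
    rw [Set.mem_singleton_iff]
    constructor
    · rintro ⟨hY, hq⟩
      rw [ne_eq, hf.quot_eq_quot_iff r r' (hgal r) (hgal r')] at hq
      push Not at hq
      obtain ⟨a, ha, b, hbY, hab, hnab⟩ := hq
      have hne : a ≠ b := by
        rintro rfl
        exact hab.asymm hab
      -- A pair whose order changes passes through `k ⊓ g`, so by codimension `Y` and `k ⊓ g` both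
      -- equal `a ⊓ b`.
      obtain ⟨h1, h2⟩ := (hagree a b hab).resolve_left hnab
      have h1 := ker_inf_ker_le h1
      have h2 := ker_inf_ker_le h2
      rw [hf.ker_eq g hgA, hf.ker_eq k hkA, hf.ker_eq _ ha.1, inf_comm] at h1
      rw [hf.ker_eq g hgA, hf.ker_eq k hkA, hf.ker_eq _ hbY.1, inf_comm] at h2
      have hab2 := inf_mem_latticeRank_two ha.1 hbY.1 hne
      rw [eq_of_le_of_mem_latticeRank hY hab2 (le_inf ha.2 hbY.2),
        eq_of_le_of_mem_latticeRank hX hab2 (le_inf h1 h2)]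
    · rintro rfl
      refine ⟨hX, fun hq => ?_⟩
      rw [hf.quot_eq_quot_iff r r' (hgal r) (hgal r')] at hq
      exact hb'.asymm (hq g hgX k hkX hb)
  · intro hq
    rw [hf.quot_eq_quot_iff r₀ r (hgal r₀) (hgal r)] at hq
    exact hb.asymm (hq k hkX g hgX hb₀)
  · rintro ⟨-, hq⟩
    -- Both `r₀` and `r'` cross `k` before `g`, which fixes the order of all hyperplanes through `k
    -- ⊓ g`.
    refine hq ((hf.quot_eq_quot_iff r₀ r' (hgal r₀) (hgal r') _).2 fun a ha b hbX hab => ?_)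
    have hdep : ∀ a ∈ A.above (k ⊓ g), ∃ α β : ℝ, f a = α • f k + β • f g := by
      intro a ha
      refine exists_eq_smul_add_smul ?_
      rw [hf.ker_eq k hkA, hf.ker_eq g hgA, hf.ker_eq a ha.1]
      exact ha.2
    exact (IsGalleryList.before_iff_of_coplanar hpos (hgal r₀) (hgal r') hkB hgB hkg hb₀ hb'
      (A.finite.mem_toFinset.2 ha.1) (A.finite.mem_toFinset.2 hbX.1) (hdep a ha)
      (hdep b hbX)).1 hab
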